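/- **Setting.** Let $\mathrm U$, $\mathrm V$ be real Banach spaces, possibly infinite dimensional, and let $(e_i)_{i\in I}$ be a linearly independent family in $\mathrm U$ with dense linear span $\mathrm U_0$ (for instance a Schauder or a Hamel basis). Let $|\cdot|$ be a norm on the tensor algebra $\mathrm T(\mathrm U_0)=\bigoplus_{k\ge 0}\mathrm U_0^{\otimes k}$ with $|\alpha\beta|\le|\alpha|\,|\beta|$ and $|\alpha|=\sum_k|\alpha^{(k)}|$ ($\alpha^{(k)}$ being the component of degree $k$), which coincides on $\mathrm U_0$ with the norm of $\mathrm U$. Let $\mathcal W$ be its completion, which is a Banach algebra; the maps $\alpha\mapsto\alpha^{(k)}$ extend to $\mathcal W$. Put $\alpha^{(\le n)}=\sum_{k\le n}\alpha^{(k)}$, $\mathcal W_{\le n}=\{\alpha^{(\le n)}:\alpha\in\mathcal W\}\cong\mathcal W/\mathcal W_{>n}$ and $\mathcal W_{\le\infty}=\mathcal W$. Let $\mathcal L$ be the closed Lie subalgebra of $\mathcal W$ generated by $\mathrm U_0$ for the bracket $[\alpha,\beta]=\alpha\beta-\beta\alpha$. **Rough path.** Fix $T\ge0$ and a control $\omega$: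 a map $(s,t)\mapsto\omega_{s,t}\ge0$ on $\{0\le s\le t\le T\}$ which is continuous at the diagonal and satisfies $\omega_{r,s}+\omega_{s,t}\le\omega_{r,t}$ for $r\le s\le t$. Let $p\ge1$, let $n\in\mathbb N$ with $n+1>p$, and let $N\in\{n,n+1,\dots\}\cup\{\infty\}$. Let $\mathbf x=(\mathbf x_{s,t})_{0\le s\le t\le T}$ be a $\mathcal W_{\le N}$-valued weak geometric $p$-rough path, i.e. $\mathbf x^{(0)}_{s,t}=1$; $|\mathbf x^{(i)}_{s,t}|\le\mu_i\,\omega_{s,t}^{i/p}$ for all $i\ge1$ and some constants $\mu_i$; $\mathbf x_{r,s}\mathbf x_{s,t}=\mathbf x_{r,t}$ in $\mathcal W_{\le N}$ for $r\le s\le t$; and $\log(\mathbf x_{s,t})$ belongs to $\mathcal L$, in the sense that the logarithm of $\mathbf x_{s,t}^{(\le m)}$ in the truncated algebra $\mathcal W_{\le m}$ belongs to $\mathcal L$ for every finite $m\le N$. **Vector fields.** Let $f_i:\mathrm V\to\mathrm V$, $i\in I$, be of class $\mathcal C^n$. Define $F^\dagger$ by $F^\dagger[1]g=g$ and $F^\dagger[e_{i}\otimes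 w]g=\mathrm D(F^\dagger[w]g)\cdot f_i$ for tensor words $w$ in the $e_j$, extended linearly, and $F[\alpha]=F^\dagger[\alpha]\mathfrak i$ with $\mathfrak i$ the identity map of $\mathrm V$. Assume that there are constants $\nu_1,\dots,\nu_n$ such that, for $1\le k\le n$ and every $\alpha\in\mathrm U_0^{\otimes k}$, the map $F[\alpha]$ is bounded by $\nu_k|\alpha|$ and Lipschitz continuous with constant $\nu_k|\alpha|$ (in particular the $f_i$ are globally Lipschitz). Then $\beta\mapsto F^\dagger[\beta^{(\le n)}]\mathfrak i(a)=F[\beta^{(\le n)}](a)$ is defined for $\beta\in\mathcal W$ by continuity. Let $\phi_{t,s}(a)=y_1$, where $y:[0,1]\to\mathrm V$ is the solution of $y'=F[\boldsymbol\lambda_{s,t}](y)$, $y_0=a$, and $\boldsymbol\lambda_{s,t}$ is the logarithm of $\mathbf x^{(\le n)}_{s,t}$ in $\mathcal W_{\le n}$ (log-ODE approximation). A *D-solution* is a continuous path $z:[0,T]\to\mathrm V$ such that, for some $\theta>1$ and some $K$, $|z_t-\phi_{t,s}(z_s)|\le K\,\omega_{s,t}^{\theta}$ for all $0\le s\le t\le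 T$. **Proposition (Consistency).** There is a constant $C$ such that any D-solution $z$ satisfies, for all $0\le s\le t\le T$, $$\bigl|z_t-F^\dagger[\mathbf x^{(\le n)}_{s,t}]\mathfrak i(z_s)\bigr|\le C\,\omega_{s,t}^{(n+1)/p}\qquad\text{and}\qquad\bigl|z_t-\phi_{t,s}(z_s)\bigr|\le C\,\omega_{s,t}^{(n+1)/p}.$$ -/

import Mathlib

namespace RoughConsistency

open Set UniformSpace

noncomputable section

/-! ### The normed tensor algebra and its completion -/

/-- The homogeneous component `α ↦ α⁽ᵏ⁾` of the algebraic tensor algebra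
`T(U) = ⨁ₖ U^{⊗k}`, seen as a map from `T(U)` to itself. -/
def algProj (U : Type*) [AddCommGroup U] [Module ℝ U] (k : ℕ) :
    TensorAlgebra ℝ U →ₗ[ℝ] TensorAlgebra ℝ U :=
  GradedAlgebra.proj
    (fun i : ℕ => LinearMap.range (TensorAlgebra.ι ℝ : U →ₗ[ℝ] TensorAlgebra ℝ U) ^ i) k

/-- An admissible norm on the tensor algebra of the normed space `U`: a submultiplicative norm
which extends the norm of `U` and satisfies `|α| = ∑ₖ |α⁽ᵏ⁾|`. -/
structure TensorNorm (U : Type*) [NormedAddCommGroup U] [NormedSpace ℝ U] extends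
    RingNorm (TensorAlgebra ℝ U) where
  smul' : ∀ (c : ℝ) (α : TensorAlgebra ℝ U), toFun (c • α) = |c| * toFun α
  norm_ι' : ∀ u : U, toFun (TensorAlgebra.ι ℝ u) = ‖u‖
  graded' : ∀ α : TensorAlgebra ℝ U, toFun α = ∑ᶠ k : ℕ, toFun (algProj U k α)

variable {U : Type*} [NormedAddCommGroup U] [NormedSpace ℝ U]

/-- The algebraic tensor algebra, endowed with the norm `𝒩`. -/
def NTensor (_𝒩 : TensorNorm U) : Type _ := TensorAlgebra ℝ U

instance (𝒩 : TensorNorm U) : NormedRing (NTensor 𝒩) :=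
  RingNorm.toNormedRing (R := TensorAlgebra ℝ U) 𝒩.toRingNorm

instance (𝒩 : TensorNorm U) : NormedAlgebra ℝ (NTensor 𝒩) where
  __ := (inferInstance : Algebra ℝ (TensorAlgebra ℝ U))
  norm_smul_le c α := (𝒩.smul' c α).le

/-- The Banach tensor algebra `𝒲`: the completion of `T(U)` for the norm `𝒩`. -/
abbrev BTensor (𝒩 : TensorNorm U) : Type _ := Completion (NTensor 𝒩)

theorem algProj_norm_le (𝒩 : TensorNorm U) (k : ℕ) (α : TensorAlgebra ℝ U) :
    𝒩.toFun (algProj U k α) ≤ 𝒩.toFun α := by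
  have hfin : (Function.support fun j : ℕ => 𝒩.toFun (algProj U j α)).Finite := by
    classical
    refine ((DirectSum.decompose (fun i : ℕ =>
      LinearMap.range (TensorAlgebra.ι ℝ : U →ₗ[ℝ] TensorAlgebra ℝ U) ^ i) α).support).finite_toSet.subset ?_
    intro j hj
    simp only [Finset.mem_coe, DFinsupp.mem_support_iff, ne_eq]
    intro h0
    apply hj
    have : algProj U j α = 0 := by
      simp only [algProj, GradedAlgebra.proj_apply, h0, ZeroMemClass.coe_zero]
    simp only [this]
    exact 𝒩.map_zero'
  rw [𝒩.graded' α]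
  exact single_le_finsum k hfin (fun j => apply_nonneg 𝒩.toRingNorm _)

/-- The component `α ↦ α⁽ᵏ⁾` on the Banach tensor algebra (extension by continuity). -/
def proj (𝒩 : TensorNorm U) (k : ℕ) : BTensor 𝒩 →L[ℝ] BTensor 𝒩 :=
  ContinuousLinearMap.completion
    (LinearMap.mkContinuous (E := NTensor 𝒩) (F := NTensor 𝒩) (algProj U k) 1
      (fun α => by rw [one_mul]; exact algProj_norm_le 𝒩 k α))

/-- The truncation `α ↦ α⁽≤ⁿ⁾ = ∑_{k ≤ n} α⁽ᵏ⁾` on the Banach tensor algebra. -/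
def trunc (𝒩 : TensorNorm U) (n : ℕ) (α : BTensor 𝒩) : BTensor 𝒩 :=
  ∑ k ∈ Finset.range (n + 1), proj 𝒩 k α

/-- The truncation `α ↦ α⁽≤ⁿ⁾` on the algebraic tensor algebra. -/
def algTrunc (U : Type*) [AddCommGroup U] [Module ℝ U] (n : ℕ) (α : TensorAlgebra ℝ U) :
    TensorAlgebra ℝ U :=
  ∑ k ∈ Finset.range (n + 1), algProj U k α

/-- The logarithm in the truncated algebra `𝒲_{≤n} = 𝒲 / 𝒲_{>n}` of an element whose component
of degree `0` is `1`: `∑_{k=1}^n (-1)^{k+1}/k (β - 1)^k` truncated at degree `n`. -/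
def logTrunc (𝒩 : TensorNorm U) (n : ℕ) (β : BTensor 𝒩) : BTensor 𝒩 :=
  trunc 𝒩 n (∑ k ∈ Finset.Icc 1 n, ((-1 : ℝ) ^ (k + 1) / (k : ℝ)) • (β - 1) ^ k)

attribute [local instance] LieRing.ofAssociativeRing

/-- The closed Lie algebra generated by `U` in the Banach tensor algebra, for the bracket
`⁅α, β⁆ = α β - β α`. -/
def closedLie (𝒩 : TensorNorm U) : Set (BTensor 𝒩) :=
  closure (LieSubalgebra.lieSpan ℝ (BTensor 𝒩)
    (range fun u : U => Completion.coe' (α := NTensor 𝒩) (TensorAlgebra.ι ℝ u)) :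
    Set (BTensor 𝒩))

/-! ### Rough paths -/

/-- A control on `{(s, t) : 0 ≤ s ≤ t ≤ T}`: nonnegative, super-additive, and continuous at the
points of the diagonal. (Super-additivity forces `ω s s = 0`.) -/
structure IsControl (T : ℝ) (ω : ℝ → ℝ → ℝ) : Prop where
  nonneg : ∀ s t, 0 ≤ s → s ≤ t → t ≤ T → 0 ≤ ω s t
  superadd : ∀ r s t, 0 ≤ r → r ≤ s → s ≤ t → t ≤ T → ω r s + ω s t ≤ ω r t
  cont_diag : ∀ r, 0 ≤ r → r ≤ T →
    ContinuousWithinAt (Function.uncurry ω)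
      {q : ℝ × ℝ | 0 ≤ q.1 ∧ q.1 ≤ q.2 ∧ q.2 ≤ T} (r, r)

/-- `x` is a `𝒲_{≤N}`-valued `p`-rough path controlled by `ω` on `[0, T]`; for `N = ⊤` it is
`𝒲`-valued. The product is that of `𝒲_{≤N} = 𝒲 / 𝒲_{>N}`. -/
structure IsRoughPath (𝒩 : TensorNorm U) (N : ℕ∞) (p T : ℝ) (ω : ℝ → ℝ → ℝ)
    (x : ℝ → ℝ → BTensor 𝒩) : Prop where
  proj_zero : ∀ s t, 0 ≤ s → s ≤ t → t ≤ T → proj 𝒩 0 (x s t) = 1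
  proj_of_lt : ∀ k : ℕ, N < (k : ℕ∞) → ∀ s t, 0 ≤ s → s ≤ t → t ≤ T → proj 𝒩 k (x s t) = 0
  bound : ∃ μ : ℕ → ℝ, ∀ i : ℕ, 1 ≤ i → ∀ s t, 0 ≤ s → s ≤ t → t ≤ T →
    ‖proj 𝒩 i (x s t)‖ ≤ μ i * ω s t ^ ((i : ℝ) / p)
  chen : ∀ r s t, 0 ≤ r → r ≤ s → s ≤ t → t ≤ T → ∀ k : ℕ, (k : ℕ∞) ≤ N →
    proj 𝒩 k (x r s * x s t) = proj 𝒩 k (x r t)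

/-- A weak geometric rough path: the logarithm of `x s t` (taken degree by degree when `N = ⊤`)
belongs to the closed Lie algebra generated by `U`. -/
structure IsWeakGeometric (𝒩 : TensorNorm U) (N : ℕ∞) (p T : ℝ) (ω : ℝ → ℝ → ℝ)
    (x : ℝ → ℝ → BTensor 𝒩) : Prop extends IsRoughPath 𝒩 N p T ω x where
  log_mem : ∀ m : ℕ, (m : ℕ∞) ≤ N → ∀ s t, 0 ≤ s → s ≤ t → t ≤ T →
    logTrunc 𝒩 m (x s t) ∈ closedLie 𝒩

/-! ### Differential operators and the Newtonian map -/

variable {V : Type*} [NormedAddCommGroup V] [NormedSpace ℝ V] {I : Type*}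

/-- The operator `F†[i₁ ⋯ iₖ]` of a word, given by `F†[∅] g = g` and
`F†[i w] g = D (F†[w] g) · fᵢ`. -/
def wordOp (f : I → V → V) : List I → (V → V) → V → V
  | [], g => g
  | i :: w, g => fun a => fderiv ℝ (wordOp f w g) a (f i a)

/-- The operator `F†[α]`, `α ∈ T(U)`: the linear extension of `F†[w]` from the words in the basis
`(eᵢ)` (that is, from the basis `e_{i₁} ⊗ ⋯ ⊗ e_{iₖ}` of `T(U)`). -/
def newtonOp (e : Module.Basis I ℝ U) (f : I → V → V) (α : TensorAlgebra ℝ U) (g : V → V) :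
    V → V :=
  (e.tensorAlgebra.repr α).sum fun w c => c • wordOp f (FreeMonoid.toList w) g

/-- For every `1 ≤ k ≤ n` the vector field `F[α] = F†[α] id`, `α ∈ U^{⊗k}`, is bounded and
Lipschitz continuous, with both constants at most `νₖ |α|`. -/
def NewtonBound (𝒩 : TensorNorm U) (e : Module.Basis I ℝ U) (f : I → V → V) (n : ℕ) : Prop :=
  ∃ ν : ℕ → ℝ, ∀ k : ℕ, 1 ≤ k → k ≤ n → ∀ α : NTensor 𝒩,
    α ∈ LinearMap.range (TensorAlgebra.ι ℝ : U →ₗ[ℝ] TensorAlgebra ℝ U) ^ k →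
      (∀ a : V, ‖newtonOp e f α id a‖ ≤ ν k * ‖α‖) ∧
      (∀ a b : V, ‖newtonOp e f α id a - newtonOp e f α id b‖ ≤ ν k * ‖α‖ * ‖a - b‖)

/-- `F[β⁽≤ⁿ⁾](a) = F†[β⁽≤ⁿ⁾] id (a)` for `β` in the Banach tensor algebra, as the continuous
extension of `α ↦ F†[α⁽≤ⁿ⁾] id (a)` from `T(U)` (under `NewtonBound` this linear map is bounded). -/
def newtonMap (𝒩 : TensorNorm U) (e : Module.Basis I ℝ U) (f : I → V → V) (n : ℕ)
    (β : BTensor 𝒩) (a : V) : V :=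
  Completion.extension (fun α : NTensor 𝒩 => newtonOp e f (algTrunc U n α) id a) β

/-! ### The log-ODE approximation and D-solutions -/

/-- `y` solves `y' = X(y)`, `y₀ = a` on `[0, 1]`. -/
def IsODESolution (X : V → V) (a : V) (y : ℝ → V) : Prop :=
  y 0 = a ∧ ∀ r ∈ Icc (0 : ℝ) 1, HasDerivWithinAt y (X (y r)) (Icc 0 1) r

open Classical in
/-- The value `y₁` at time `1` of a solution of `y' = X(y)`, `y₀ = a` (unique for Lipschitz `X`;
by convention `a` if there is no solution). -/
def timeOne (X : V → V) (a : V) : V :=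
  if h : ∃ y : ℝ → V, IsODESolution X a y then h.choose 1 else a

/-- The log-ODE approximation `φ_{t,s}(a) = y₁[λ_{s,t}](a)` with `λ_{s,t} = log (x_{s,t}⁽≤ⁿ⁾)`,
where `y[λ](a)` solves `y' = F[λ](y)`, `y₀ = a`. -/
def logODE (𝒩 : TensorNorm U) (e : Module.Basis I ℝ U) (f : I → V → V) (n : ℕ)
    (x : ℝ → ℝ → BTensor 𝒩) (t s : ℝ) (a : V) : V :=
  timeOne (newtonMap 𝒩 e f n (logTrunc 𝒩 n (x s t))) a

/-- D-solutions on `[0, T]`: continuous paths with `|z_t - φ_{t,s}(z_s)| ≤ K ω_{s,t}^θ` for some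
`θ > 1` and some `K`. (Paths satisfying this with `θ = (n + 1) / p > 1` are a special case.) -/
def IsDSolution (𝒩 : TensorNorm U) (e : Module.Basis I ℝ U) (f : I → V → V) (n : ℕ) (T : ℝ)
    (ω : ℝ → ℝ → ℝ) (x : ℝ → ℝ → BTensor 𝒩) (z : ℝ → V) : Prop :=
  ContinuousOn z (Icc 0 T) ∧
    ∃ θ : ℝ, 1 < θ ∧ ∃ K : ℝ, ∀ s t, 0 ≤ s → s ≤ t → t ≤ T →
      ‖z t - logODE 𝒩 e f n x t s (z s)‖ ≤ K * ω s t ^ θ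

end

end RoughConsistency

open RoughConsistency

namespace RoughConsistency

open Set UniformSpace

noncomputable section

attribute [local instance] LieRing.ofAssociativeRing

/-! ### Homogeneous components -/

section AlgProj

variable {U : Type*} [AddCommGroup U] [Module ℝ U]

/-! Two facts carry the result. The log-ODE scheme φ is an almost flow with defect of order
ω^{(n+1)/p}, where (n+1)/p > 1, and it agrees with F[x] to the same order. Moreover, any path which
follows an almost flow with an error K ω^θ, θ > 1, follows it with the order of the defect, with a
constant independent of θ, K and the path.

For the first fact, let l = log x_{r,s} and let y solve y' = F[l](y), y_0 = a. Since l is a Lie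
element, its components act through F† as first order operators (`IsDerivation.lie`), so the
derivative of F[β](y) along the flow is F[lβ](y), up to products of components whose degrees add up
to more than n. If the component of degree k has size ε^k, with ε a power 1/p of the control, these
products are O(ε^{n+1}). Taylor's formula in time then gives F[β](y_1) = F[exp(l) β](a) + O(ε^{n+1})
= F[x_{r,s} β](a) + O(ε^{n+1}) (`NewtonCalculus.exists_expansion`). The choice β = 1 compares φ with
F[x]; the choice β = x_{s,t}, with Chen's relation, gives the almost flow property
(`exists_logODE_estimates`). The expansion differentiates each F[β] only once. The algebra is done
on T(U₀) and reaches the completion by density and uniform bounds (`NewtonConst.exists_calculus`).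

For the second fact, the estimate on an interval is deduced from the estimates on two parts carrying
at most half of the control (`exists_consistency_const`). Each halving multiplies the term in K by
2^{1-θ} < 1, while the defects of the flow sum to a multiple of ω^{(n+1)/p}. A control continuous
only at the diagonal may have no exact midpoint, so the two parts are separated by a gap of
arbitrarily small control (`IsControl.exists_halving`), on which the bound K ω^θ is negligible. -/

/-- The homogeneous elements of degree `k` in the tensor algebra. -/
abbrev homog (U : Type*) [AddCommGroup U] [Module ℝ U] (k : ℕ) :
    Submodule ℝ (TensorAlgebra ℝ U) :=
  LinearMap.range (TensorAlgebra.ι ℝ : U →ₗ[ℝ] TensorAlgebra ℝ U) ^ k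

theorem algProj_mem (k : ℕ) (α : TensorAlgebra ℝ U) : algProj U k α ∈ homog U k := by
  rw [algProj, GradedAlgebra.proj_apply]
  exact SetLike.coe_mem _

theorem algProj_of_mem {j : ℕ} {α : TensorAlgebra ℝ U} (h : α ∈ homog U j) (k : ℕ) :
    algProj U k α = if j = k then α else 0 := by
  rw [algProj, GradedAlgebra.proj_apply]
  split_ifs with hjk
  · subst hjk
    exact DirectSum.decompose_of_mem_same _ h
  · exact DirectSum.decompose_of_mem_ne _ h hjk

theorem algProj_algProj (j k : ℕ) (α : TensorAlgebra ℝ U) :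
    algProj U k (algProj U j α) = if j = k then algProj U j α else 0 :=
  algProj_of_mem (algProj_mem j α) k

theorem homog_induction {P : TensorAlgebra ℝ U → Prop}
    (hmem : ∀ k α, α ∈ homog U k → P α) (hadd : ∀ α β, P α → P β → P (α + β)) (α) : P α := by
  refine DirectSum.Decomposition.inductionOn (homog U) (hmem 0 0 (zero_mem _))
    (fun {i} m => hmem i m m.2) hadd α

theorem algProj_mul (k : ℕ) (α β : TensorAlgebra ℝ U) :
    algProj U k (α * β) = ∑ q ∈ Finset.HasAntidiagonal.antidiagonal k, algProj U q.1 α * algProj U q.2 β := by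
  induction α using homog_induction with
  | hadd α γ h1 h2 => simp only [add_mul, map_add, h1, h2, Finset.sum_add_distrib]
  | hmem i α hα =>
    induction β using homog_induction with
    | hadd β γ h1 h2 => simp only [mul_add, map_add, h1, h2, Finset.sum_add_distrib]
    | hmem j β hβ =>
      have hαβ : α * β ∈ homog U (i + j) := by
        rw [homog, pow_add]; exact Submodule.mul_mem_mul hα hβ
      rw [algProj_of_mem hαβ]
      simp only [algProj_of_mem hα, algProj_of_mem hβ]
      split_ifs with h
      · rw [Finset.sum_eq_single (i, j)]
        · simp
        · rintro ⟨a, b⟩ _ hne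
          by_cases h1 : i = a
          · have : j ≠ b := fun h2 => hne (by rw [h1, h2])
            simp [this]
          · simp [h1]
        · intro h'; exact absurd (Finset.HasAntidiagonal.mem_antidiagonal.2 h) h'
      · symm
        apply Finset.sum_eq_zero
        rintro ⟨a, b⟩ hq
        rw [Finset.HasAntidiagonal.mem_antidiagonal] at hq
        by_cases h1 : i = a
        · have : j ≠ b := by rintro rfl; subst h1; exact h hq
          simp [this]
        · simp [h1]

theorem algProj_one (k : ℕ) : algProj U k 1 = if k = 0 then 1 else 0 := by
  have : (1 : TensorAlgebra ℝ U) ∈ homog U 0 := by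
    rw [homog, pow_zero]; exact Submodule.one_le.1 le_rfl
  rw [algProj_of_mem this]
  simp [eq_comm]

end AlgProj

/-! ### Components, truncated equality and homogeneous size in the completed algebra. -/

section Proj

variable {U : Type*} [NormedAddCommGroup U] [NormedSpace ℝ U] {𝒩 : TensorNorm U}

/-- The embedding of the tensor algebra into its completion, as a continuous linear map. -/
def coeL (𝒩 : TensorNorm U) : NTensor 𝒩 →L[ℝ] BTensor 𝒩 := Completion.toComplL

theorem denseRange_coeL : DenseRange (coeL 𝒩) := Completion.denseRange_coe

theorem coeL_mul (α β : NTensor 𝒩) : coeL 𝒩 (α * β) = coeL 𝒩 α * coeL 𝒩 β :=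
  Completion.coe_mul α β

theorem coeL_one : coeL 𝒩 1 = 1 := rfl

theorem norm_coeL (α : NTensor 𝒩) : ‖coeL 𝒩 α‖ = ‖α‖ := Completion.norm_coe α

/-- The component of degree `k`, on the normed tensor algebra. -/
def nProj (𝒩 : TensorNorm U) (k : ℕ) : NTensor 𝒩 →L[ℝ] NTensor 𝒩 :=
  LinearMap.mkContinuous (E := NTensor 𝒩) (F := NTensor 𝒩) (algProj U k) 1
      (fun α => by rw [one_mul]; exact algProj_norm_le 𝒩 k α)

theorem norm_nProj_le (k : ℕ) (α : NTensor 𝒩) : ‖nProj 𝒩 k α‖ ≤ ‖α‖ := algProj_norm_le 𝒩 k α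

theorem proj_coeL (k : ℕ) (α : NTensor 𝒩) : proj 𝒩 k (coeL 𝒩 α) = coeL 𝒩 (nProj 𝒩 k α) :=
  ContinuousLinearMap.completion_apply_coe _ α

theorem nProj_mul (k : ℕ) (α β : NTensor 𝒩) :
    nProj 𝒩 k (α * β) = ∑ q ∈ Finset.HasAntidiagonal.antidiagonal k, nProj 𝒩 q.1 α * nProj 𝒩 q.2 β :=
  algProj_mul k α β

theorem nProj_nProj (j k : ℕ) (α : NTensor 𝒩) :
    nProj 𝒩 k (nProj 𝒩 j α) = if j = k then nProj 𝒩 j α else 0 := algProj_algProj j k α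

theorem proj_proj (j k : ℕ) (α : BTensor 𝒩) :
    proj 𝒩 k (proj 𝒩 j α) = if j = k then proj 𝒩 j α else 0 := by
  induction α using denseRange_coeL.induction_on with
  | hp => split_ifs <;> exact isClosed_eq (by fun_prop) (by fun_prop)
  | ih α =>
    rw [proj_coeL, proj_coeL, nProj_nProj]
    split_ifs <;> simp

theorem proj_mul (k : ℕ) (α β : BTensor 𝒩) :
    proj 𝒩 k (α * β) = ∑ q ∈ Finset.HasAntidiagonal.antidiagonal k, proj 𝒩 q.1 α * proj 𝒩 q.2 β := by
  induction α, β using denseRange_coeL.induction_on₂ with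
  | hp => exact isClosed_eq (by fun_prop) (by fun_prop)
  | h α β =>
    rw [← coeL_mul, proj_coeL, nProj_mul, map_sum]
    simp only [coeL_mul, proj_coeL]

theorem proj_one (k : ℕ) : proj 𝒩 k 1 = if k = 0 then 1 else 0 := by
  rw [← coeL_one, proj_coeL]
  have : nProj 𝒩 k 1 = if k = 0 then 1 else 0 := algProj_one k
  rw [this]
  split_ifs <;> simp [coeL_one]

theorem proj_trunc {n k : ℕ} (h : k ≤ n) (α : BTensor 𝒩) :
    proj 𝒩 k (trunc 𝒩 n α) = proj 𝒩 k α := by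
  rw [trunc, map_sum, Finset.sum_eq_single k]
  · rw [proj_proj, if_pos rfl]
  · intro b _ hb; rw [proj_proj, if_neg hb]
  · intro h'; exact absurd (Finset.mem_range.2 (by omega)) h'

/-- Equality in the truncated algebra `𝒲_{≤n}`. -/
def TruncEq (n : ℕ) (α β : BTensor 𝒩) : Prop := ∀ k ≤ n, proj 𝒩 k α = proj 𝒩 k β

theorem TruncEq.refl {n : ℕ} (α : BTensor 𝒩) : TruncEq n α α := fun _ _ => rfl

theorem TruncEq.symm {n : ℕ} {α β : BTensor 𝒩} (h : TruncEq n α β) : TruncEq n β α :=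
  fun k hk => (h k hk).symm

theorem TruncEq.trans {n : ℕ} {α β γ : BTensor 𝒩} (h : TruncEq n α β) (h' : TruncEq n β γ) :
    TruncEq n α γ := fun k hk => (h k hk).trans (h' k hk)

theorem TruncEq.mul {n : ℕ} {α β α' β' : BTensor 𝒩} (h : TruncEq n α β) (h' : TruncEq n α' β') :
    TruncEq n (α * α') (β * β') := by
  intro k hk
  rw [proj_mul, proj_mul]
  refine Finset.sum_congr rfl fun q hq => ?_
  have := Finset.HasAntidiagonal.mem_antidiagonal.1 hq
  rw [h q.1 (by omega), h' q.2 (by omega)]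

theorem TruncEq.pow {n : ℕ} {α β : BTensor 𝒩} (h : TruncEq n α β) (m : ℕ) :
    TruncEq n (α ^ m) (β ^ m) := by
  induction m with
  | zero => simpa using TruncEq.refl 1
  | succ m ih => rw [pow_succ, pow_succ]; exact ih.mul h

theorem TruncEq.sum_smul {n : ℕ} {ι : Type*} (s : Finset ι) (c : ι → ℝ) {α β : ι → BTensor 𝒩}
    (h : ∀ i ∈ s, TruncEq n (α i) (β i)) :
    TruncEq n (∑ i ∈ s, c i • α i) (∑ i ∈ s, c i • β i) := by
  intro k hk
  simp only [map_sum, map_smul]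
  exact Finset.sum_congr rfl fun i hi => by rw [h i hi k hk]

theorem truncEq_trunc (n : ℕ) (α : BTensor 𝒩) : TruncEq n (trunc 𝒩 n α) α :=
  fun _ hk => proj_trunc hk α

/-- Powers of an element without constant term have no component of low degree. -/
theorem proj_pow_eq_zero {α : BTensor 𝒩} (h : proj 𝒩 0 α = 0) {m k : ℕ} (hk : k < m) :
    proj 𝒩 k (α ^ m) = 0 := by
  induction m generalizing k with
  | zero => omega
  | succ m ih =>
    rw [pow_succ, proj_mul]
    refine Finset.sum_eq_zero fun q hq => ?_
    have := Finset.HasAntidiagonal.mem_antidiagonal.1 hq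
    rcases Nat.eq_zero_or_pos q.2 with h0 | h0
    · rw [h0, h, mul_zero]
    · rw [ih (by omega), zero_mul]

/-- `α` is of size `ε`, with constant `M`, in the homogeneous sense, up to degree `n`. -/
def Scaled (n : ℕ) (ε M : ℝ) (α : BTensor 𝒩) : Prop := ∀ k ≤ n, ‖proj 𝒩 k α‖ ≤ M * ε ^ k

variable {n : ℕ} {ε M M' : ℝ} {α β : BTensor 𝒩}

theorem Scaled.congr (h : Scaled n ε M α) (h' : TruncEq n α β) : Scaled n ε M β :=
  fun k hk => by rw [← h' k hk]; exact h k hk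

theorem Scaled.nonneg (h : Scaled n ε M α) : 0 ≤ M := by
  simpa using (norm_nonneg _).trans (h 0 (Nat.zero_le _))

theorem Scaled.mono {ε' : ℝ} (h : Scaled n ε M α) (h0 : 0 ≤ ε) (hε : ε ≤ ε') (hM : M ≤ M') :
    Scaled n ε' M' α := fun k hk => (h k hk).trans <|
  mul_le_mul hM (pow_le_pow_left₀ h0 hε k) (pow_nonneg h0 k) (h.nonneg.trans hM)

/-- The powers of ε add up along each splitting of the degree; n + 1 bounds the number of splittings
of a degree k ≤ n. -/
theorem Scaled.mul (h : Scaled n ε M α) (h' : Scaled n ε M' β) (h0 : 0 ≤ ε) :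
    Scaled n ε ((n + 1) * (M * M')) (α * β) := by
  intro k hk
  rw [proj_mul]
  calc _ ≤ ∑ q ∈ Finset.HasAntidiagonal.antidiagonal k, M * M' * ε ^ k := by
        refine norm_sum_le_of_le _ fun q hq => ?_
        have hq := Finset.HasAntidiagonal.mem_antidiagonal.1 hq
        refine (norm_mul_le _ _).trans ?_
        calc _ ≤ (M * ε ^ q.1) * (M' * ε ^ q.2) :=
              mul_le_mul (h _ (by omega)) (h' _ (by omega)) (norm_nonneg _)
                (mul_nonneg h.nonneg (pow_nonneg h0 _))
          _ = M * M' * ε ^ k := by rw [← hq, pow_add]; ring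
    _ = (k + 1 : ℝ) * (M * M' * ε ^ k) := by simp
    _ ≤ (n + 1 : ℝ) * (M * M' * ε ^ k) := by
        have : (k : ℝ) ≤ n := by exact_mod_cast hk
        have h1 := mul_nonneg (mul_nonneg h.nonneg h'.nonneg) (pow_nonneg h0 k)
        gcongr
    _ = _ := by ring

theorem Scaled.pow_mul (h : Scaled n ε M α) (h' : Scaled n ε M' β) (h0 : 0 ≤ ε) (m : ℕ) :
    Scaled n ε (((n + 1) * M) ^ m * M') (α ^ m * β) := by
  induction m with
  | zero => simpa using h'
  | succ m ih =>
    have := h.mul ih h0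
    rw [pow_succ' α, mul_assoc]
    convert this using 1
    ring

theorem Scaled.sum_smul {ι : Type*} (s : Finset ι) (c : ι → ℝ) {α : ι → BTensor 𝒩} {M : ι → ℝ}
    (h : ∀ i ∈ s, Scaled n ε (M i) (α i)) :
    Scaled n ε (∑ i ∈ s, |c i| * M i) (∑ i ∈ s, c i • α i) := by
  intro k hk
  rw [map_sum, Finset.sum_mul]
  refine norm_sum_le_of_le _ fun i hi => ?_
  rw [map_smul, norm_smul, Real.norm_eq_abs, mul_assoc]
  exact mul_le_mul_of_nonneg_left (h i hi k hk) (abs_nonneg _)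

end Proj

/-! ### Words in a basis -/

section Words

variable {U : Type*} [AddCommGroup U] [Module ℝ U] {I : Type*}

/-- Unfolds the library basis of the tensor algebra: words are products of basis vectors, which
makes concatenation correspond to multiplication. -/
theorem tensorAlgebra_basis_apply (e : Module.Basis I ℝ U) (w : FreeMonoid I) :
    e.tensorAlgebra w = FreeMonoid.lift (fun i => TensorAlgebra.ι ℝ (e i)) w := by
  change (TensorAlgebra.equivFreeAlgebra e).symm
      (FreeAlgebra.equivMonoidAlgebraFreeMonoid.symm (MonoidAlgebra.single w (1 : ℝ))) = _
  simp only [FreeAlgebra.equivMonoidAlgebraFreeMonoid, AlgEquiv.ofAlgHom_symm_apply,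
    MonoidAlgebra.lift_single, one_smul]
  induction w using FreeMonoid.inductionOn' with
  | one => simp
  | of_mul i w ih =>
    rw [map_mul, map_mul, map_mul, ih, FreeMonoid.lift_eval_of, FreeMonoid.lift_eval_of,
      TensorAlgebra.equivFreeAlgebra_symm_ι]

theorem tensorAlgebra_basis_one (e : Module.Basis I ℝ U) : e.tensorAlgebra 1 = 1 := by
  rw [tensorAlgebra_basis_apply, map_one]

theorem tensorAlgebra_basis_mul (e : Module.Basis I ℝ U) (v w : FreeMonoid I) :
    e.tensorAlgebra (v * w) = e.tensorAlgebra v * e.tensorAlgebra w := by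
  simp only [tensorAlgebra_basis_apply, map_mul]

theorem tensorAlgebra_basis_mem (e : Module.Basis I ℝ U) (w : FreeMonoid I) :
    e.tensorAlgebra w ∈ homog U (FreeMonoid.toList w).length := by
  induction w using FreeMonoid.inductionOn' with
  | one =>
    rw [tensorAlgebra_basis_one, FreeMonoid.toList_one, List.length_nil, homog, pow_zero]
    exact Submodule.one_le.1 le_rfl
  | of_mul i w ih =>
    rw [tensorAlgebra_basis_mul, tensorAlgebra_basis_apply e (FreeMonoid.of i),
      FreeMonoid.lift_eval_of, FreeMonoid.toList_of_mul, List.length_cons, homog,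
      pow_succ']
    exact Submodule.mul_mem_mul (LinearMap.mem_range_self _ _) ih

/-- A homogeneous element is a linear combination of words of its degree. -/
theorem homog_le_span (e : Module.Basis I ℝ U) (k : ℕ) :
    homog U k ≤ Submodule.span ℝ (e.tensorAlgebra '' {w | (FreeMonoid.toList w).length = k}) := by
  intro α hα
  have h1 : algProj U k α = α := by rw [algProj_of_mem hα, if_pos rfl]
  rw [← h1, ← e.tensorAlgebra.linearCombination_repr α, Finsupp.linearCombination_apply,
    Finsupp.sum, map_sum]
  refine Submodule.sum_mem _ fun w _ => ?_
  rw [map_smul, algProj_of_mem (tensorAlgebra_basis_mem e w)]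
  refine Submodule.smul_mem _ _ ?_
  split_ifs with h
  · exact Submodule.subset_span ⟨w, h, rfl⟩
  · exact zero_mem _

theorem homog_word_induction (e : Module.Basis I ℝ U) {k : ℕ}
    {P : (α : TensorAlgebra ℝ U) → α ∈ homog U k → Prop}
    (word : ∀ (w : FreeMonoid I) (hw : (FreeMonoid.toList w).length = k),
      P (e.tensorAlgebra w) (hw ▸ tensorAlgebra_basis_mem e w))
    (zero : P 0 (zero_mem _))
    (add : ∀ α hα β hβ, P α hα → P β hβ → P (α + β) (add_mem hα hβ))
    (smul : ∀ (c : ℝ) (α) (hα), P α hα → P (c • α) (Submodule.smul_mem _ c hα))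
    (α : TensorAlgebra ℝ U) (hα : α ∈ homog U k) : P α hα := by
  have hle : Submodule.span ℝ (e.tensorAlgebra '' {w | (FreeMonoid.toList w).length = k}) ≤
      homog U k := by
    rw [Submodule.span_le]
    rintro _ ⟨w, rfl, rfl⟩
    exact tensorAlgebra_basis_mem e w
  refine Submodule.span_induction (p := fun x hx => P x (hle hx)) ?_ zero
    (fun x y hx hy => add x (hle hx) y (hle hy)) (fun c x hx => smul c x (hle hx))
    (homog_le_span e k hα)
  rintro _ ⟨w, hw, rfl⟩
  exact word w hw

end Words

/-! ### The operators `F†` -/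

section WordOp

variable {V : Type*} [NormedAddCommGroup V] [NormedSpace ℝ V] {I : Type*} {f : I → V → V} {n : ℕ}

/-- Each letter costs one derivative of what stands to its right. The outermost derivative falls on
g and not on a vector field, so fields of class 𝒞ⁿ leave n + 1 - |w| derivatives for a word w
applied to a smooth g; a word of length n is still 𝒞¹. -/
theorem contDiff_wordOp (hf : ∀ i, ContDiff ℝ n (f i)) (w : List I) (m : ℕ)
    (hm : m + w.length ≤ n + 1) {g : V → V} (hg : ContDiff ℝ ((m + w.length : ℕ)) g) :
    ContDiff ℝ m (wordOp f w g) := by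
  induction w generalizing m with
  | nil => exact hg
  | cons i w ih =>
    rw [List.length_cons] at hm hg
    have h1 : ContDiff ℝ ((m + 1 : ℕ)) (wordOp f w g) :=
      ih (m + 1) (by omega) (by rwa [show m + 1 + w.length = m + (w.length + 1) by omega])
    exact (h1.fderiv_right (m := m) (by norm_cast)).clm_apply
      ((hf i).of_le (by exact_mod_cast (by omega : m ≤ n)))

theorem wordOp_append (u w : List I) (g : V → V) :
    wordOp f (u ++ w) g = wordOp f u (wordOp f w g) := by
  induction u with
  | nil => rfl
  | cons i u ih => simp only [List.cons_append, wordOp, ih]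

theorem differentiable_wordOp (hf : ∀ i, ContDiff ℝ n (f i)) {w : List I}
    (hm : w.length ≤ n) {g : V → V} (hg : ContDiff ℝ ((w.length + 1 : ℕ)) g) :
    Differentiable ℝ (wordOp f w g) :=
  (contDiff_wordOp hf w 1 (by omega) (by rwa [add_comm])).differentiable (by norm_num)

theorem wordOp_add (hf : ∀ i, ContDiff ℝ n (f i)) (w : List I) (hw : w.length ≤ n + 1)
    {g h : V → V} (hg : ContDiff ℝ (w.length : ℕ) g) (hh : ContDiff ℝ (w.length : ℕ) h) :
    wordOp f w (g + h) = wordOp f w g + wordOp f w h := by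
  induction w with
  | nil => rfl
  | cons i w ih =>
    rw [List.length_cons] at hw hg hh
    funext a
    simp only [wordOp, Pi.add_apply]
    rw [ih (by omega) (hg.of_le (by norm_cast; omega)) (hh.of_le (by norm_cast; omega)),
      fderiv_add (differentiable_wordOp hf (by omega) hg a)
        (differentiable_wordOp hf (by omega) hh a)]
    rfl

theorem wordOp_smul (hf : ∀ i, ContDiff ℝ n (f i)) (w : List I) (hw : w.length ≤ n + 1)
    (c : ℝ) {g : V → V} (hg : ContDiff ℝ (w.length : ℕ) g) :
    wordOp f w (c • g) = c • wordOp f w g := by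
  induction w with
  | nil => rfl
  | cons i w ih =>
    rw [List.length_cons] at hw hg
    funext a
    simp only [wordOp, Pi.smul_apply]
    rw [ih (by omega) (hg.of_le (by norm_cast; omega)),
      fderiv_const_smul (differentiable_wordOp hf (by omega) hg a)]
    rfl

theorem wordOp_zero (w : List I) : wordOp f w (0 : V → V) = 0 := by
  induction w with
  | nil => rfl
  | cons i w ih => funext a; simp [wordOp, ih]

end WordOp

/-! ### The operators `F†` on tensors: linearity, product rule and derivations. -/

section NewtonOp

variable {U : Type*} [NormedAddCommGroup U] [NormedSpace ℝ U]
  {V : Type*} [NormedAddCommGroup V] [NormedSpace ℝ V] {I : Type*}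
  {e : Module.Basis I ℝ U} {f : I → V → V} {n : ℕ}

/-- `F†` as a linear map. -/
def newtonLin (e : Module.Basis I ℝ U) (f : I → V → V) (g : V → V) :
    TensorAlgebra ℝ U →ₗ[ℝ] (V → V) :=
  (Finsupp.linearCombination ℝ (fun w : FreeMonoid I => wordOp f (FreeMonoid.toList w) g)) ∘ₗ
    e.tensorAlgebra.repr.toLinearMap

theorem newtonLin_apply (α : TensorAlgebra ℝ U) (g : V → V) :
    newtonLin e f g α = newtonOp e f α g := rfl

theorem newtonOp_zero (g : V → V) : newtonOp e f 0 g = 0 := map_zero (newtonLin e f g)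

theorem newtonOp_add (α β : TensorAlgebra ℝ U) (g : V → V) :
    newtonOp e f (α + β) g = newtonOp e f α g + newtonOp e f β g := map_add (newtonLin e f g) α β

theorem newtonOp_sub (α β : TensorAlgebra ℝ U) (g : V → V) :
    newtonOp e f (α - β) g = newtonOp e f α g - newtonOp e f β g := map_sub (newtonLin e f g) α β

theorem newtonOp_smul (c : ℝ) (α : TensorAlgebra ℝ U) (g : V → V) :
    newtonOp e f (c • α) g = c • newtonOp e f α g := map_smul (newtonLin e f g) c α

theorem newtonOp_basis (w : FreeMonoid I) (g : V → V) :
    newtonOp e f (e.tensorAlgebra w) g = wordOp f (FreeMonoid.toList w) g := by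
  rw [← newtonLin_apply, newtonLin, LinearMap.comp_apply, LinearEquiv.coe_coe,
    Module.Basis.repr_self, Finsupp.linearCombination_single, one_smul]

theorem newtonOp_one (g : V → V) : newtonOp e f 1 g = g := by
  rw [← tensorAlgebra_basis_one e, newtonOp_basis]; rfl

theorem contDiff_newtonOp (hf : ∀ i, ContDiff ℝ n (f i)) {k m : ℕ} (hm : m + k ≤ n + 1)
    {g : V → V} (hg : ContDiff ℝ ((m + k : ℕ)) g) {α : TensorAlgebra ℝ U} (hα : α ∈ homog U k) :
    ContDiff ℝ m (newtonOp e f α g) := by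
  induction α, hα using homog_word_induction e with
  | word w hw =>
    subst hw
    rw [newtonOp_basis]
    exact contDiff_wordOp hf _ m hm hg
  | zero => rw [newtonOp_zero]; exact contDiff_const
  | add α _ β _ h1 h2 => rw [newtonOp_add]; exact h1.add h2
  | smul c α _ h1 => rw [newtonOp_smul]; exact contDiff_const.smul h1

theorem newtonOp_add_right (hf : ∀ i, ContDiff ℝ n (f i)) {k : ℕ} (hk : k ≤ n + 1)
    {g h : V → V} (hg : ContDiff ℝ k g) (hh : ContDiff ℝ k h)
    {α : TensorAlgebra ℝ U} (hα : α ∈ homog U k) :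
    newtonOp e f α (g + h) = newtonOp e f α g + newtonOp e f α h := by
  induction α, hα using homog_word_induction e with
  | word w hw =>
    subst hw
    simp only [newtonOp_basis]
    exact wordOp_add hf _ hk hg hh
  | zero => simp only [newtonOp_zero, add_zero]
  | add α _ β _ h1 h2 => simp only [newtonOp_add, h1, h2]; abel
  | smul c α _ h1 => simp only [newtonOp_smul, h1, smul_add]

theorem newtonOp_smul_right (hf : ∀ i, ContDiff ℝ n (f i)) {k : ℕ} (hk : k ≤ n + 1)
    (c : ℝ) {g : V → V} (hg : ContDiff ℝ k g) {α : TensorAlgebra ℝ U} (hα : α ∈ homog U k) :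
    newtonOp e f α (c • g) = c • newtonOp e f α g := by
  induction α, hα using homog_word_induction e with
  | word w hw =>
    subst hw
    simp only [newtonOp_basis]
    exact wordOp_smul hf _ hk c hg
  | zero => simp only [newtonOp_zero, smul_zero]
  | add α _ β _ h1 h2 => simp only [newtonOp_add, h1, h2, smul_add]
  | smul d α _ h1 => simp only [newtonOp_smul, h1, smul_comm c d]

theorem newtonOp_zero_right {k : ℕ} {α : TensorAlgebra ℝ U} (hα : α ∈ homog U k) :
    newtonOp e f α 0 = 0 := by
  induction α, hα using homog_word_induction e with
  | word w hw => rw [newtonOp_basis, wordOp_zero]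
  | zero => rw [newtonOp_zero]
  | add α _ β _ h1 h2 => rw [newtonOp_add, h1, h2, add_zero]
  | smul d α _ h1 => rw [newtonOp_smul, h1, smul_zero]

/-- `F†[αβ] = F†[α] F†[β]`. -/
theorem newtonOp_mul (hf : ∀ i, ContDiff ℝ n (f i)) {i j : ℕ} (hij : i + j ≤ n + 1)
    {g : V → V} (hg : ContDiff ℝ ((i + j : ℕ)) g) {α β : TensorAlgebra ℝ U}
    (hα : α ∈ homog U i) (hβ : β ∈ homog U j) :
    newtonOp e f (α * β) g = newtonOp e f α (newtonOp e f β g) := by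
  induction β, hβ using homog_word_induction e with
  | word w hw =>
    induction α, hα using homog_word_induction e with
    | word v hv =>
      rw [← tensorAlgebra_basis_mul]
      simp only [newtonOp_basis, FreeMonoid.toList_mul, wordOp_append]
    | zero => simp only [zero_mul, newtonOp_zero]
    | add α _ β _ h1 h2 => simp only [add_mul, newtonOp_add, h1, h2]
    | smul d α _ h1 => simp only [smul_mul_assoc, newtonOp_smul, h1]
  | zero => rw [mul_zero, newtonOp_zero, newtonOp_zero_right hα]
  | add β hβ γ hγ h1 h2 =>
    rw [mul_add, newtonOp_add, newtonOp_add, h1, h2, newtonOp_add_right hf (by omega)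
      (contDiff_newtonOp hf (by omega) hg hβ) (contDiff_newtonOp hf (by omega) hg hγ) hα]
  | smul c β hβ h1 =>
    rw [mul_smul_comm, newtonOp_smul, newtonOp_smul, h1, newtonOp_smul_right hf (by omega) c
      (contDiff_newtonOp hf (by omega) hg hβ) hα]

/-- `F†[α]` is a first order differential operator on functions of class `𝒞ᵏ`. -/
def IsDerivation (e : Module.Basis I ℝ U) (f : I → V → V) (k : ℕ) (α : TensorAlgebra ℝ U) : Prop :=
  ∀ g : V → V, ContDiff ℝ k g →
    newtonOp e f α g = fun a => fderiv ℝ g a (newtonOp e f α id a)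

theorem IsDerivation.zero (k : ℕ) : IsDerivation e f k 0 := by
  intro g _
  simp only [newtonOp_zero]
  funext a
  simp

theorem IsDerivation.add {k : ℕ} {α β : TensorAlgebra ℝ U} (h : IsDerivation e f k α)
    (h' : IsDerivation e f k β) : IsDerivation e f k (α + β) := by
  intro g hg
  rw [newtonOp_add, newtonOp_add, h g hg, h' g hg]
  funext a
  simp

theorem IsDerivation.smul {k : ℕ} {α : TensorAlgebra ℝ U} (c : ℝ) (h : IsDerivation e f k α) :
    IsDerivation e f k (c • α) := by
  intro g hg
  rw [newtonOp_smul, newtonOp_smul, h g hg]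
  funext a
  simp

theorem IsDerivation.sum {ι : Type*} {k : ℕ} (s : Finset ι) {α : ι → TensorAlgebra ℝ U}
    (h : ∀ i ∈ s, IsDerivation e f k (α i)) : IsDerivation e f k (∑ i ∈ s, α i) := by
  classical
  induction s using Finset.induction_on with
  | empty => exact IsDerivation.zero k
  | insert i s hi ih =>
    rw [Finset.sum_insert hi]
    exact (h i (Finset.mem_insert_self i s)).add
      (ih fun j hj => h j (Finset.mem_insert_of_mem hj))

theorem isDerivation_of_mem_one {k : ℕ} {α : TensorAlgebra ℝ U} (hα : α ∈ homog U 1) :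
    IsDerivation e f k α := by
  induction α, hα using homog_word_induction e with
  | word w hw =>
    obtain ⟨i, hi⟩ := List.length_eq_one_iff.1 hw
    intro g _
    simp only [newtonOp_basis, hi, wordOp]
    simp
  | zero => exact IsDerivation.zero k
  | add α _ β _ h1 h2 => exact h1.add h2
  | smul c α _ h1 => exact h1.smul c

/-- The commutator of two first order operators is of first order because the second derivative of g
is symmetric: the remaining field is the Lie bracket of the two vector fields. The degrees i and j
are exactly the regularity consumed by each factor, so `F†[β] g` is still regular enough for the
hypothesis on α, and conversely. -/
theorem IsDerivation.lie (hf : ∀ i, ContDiff ℝ n (f i)) {i j : ℕ} (hi : 1 ≤ i) (hj : 1 ≤ j)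
    (hij : i + j ≤ n) {α β : TensorAlgebra ℝ U} (hα : α ∈ homog U i) (hβ : β ∈ homog U j)
    (h : IsDerivation e f i α) (h' : IsDerivation e f j β) :
    IsDerivation e f (i + j) (α * β - β * α) := by
  have hid : ∀ m : ℕ, ContDiff ℝ m (id : V → V) := fun m => contDiff_id
  intro g hg
  have hg' : ContDiff ℝ ((j + i : ℕ)) g := by rwa [add_comm]
  have hFα : ContDiff ℝ j (newtonOp e f α id) := contDiff_newtonOp hf (by omega) (hid _) hα
  have hFβ : ContDiff ℝ i (newtonOp e f β id) := contDiff_newtonOp hf (by omega) (hid _) hβ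
  have hgα : ContDiff ℝ j (newtonOp e f α g) := contDiff_newtonOp hf (by omega) hg' hα
  have hgβ : ContDiff ℝ i (newtonOp e f β g) := contDiff_newtonOp hf (by omega) hg hβ
  funext a
  rw [newtonOp_sub, newtonOp_sub, newtonOp_mul hf (by omega) hg hα hβ,
    newtonOp_mul hf (by omega) (hid _) hα hβ, newtonOp_mul hf (by omega) hg' hβ hα,
    newtonOp_mul hf (by omega) (hid _) hβ hα, h _ hgβ, h' _ hgα, h _ hFβ, h' _ hFα,
    h' g (hg.of_le (by norm_cast; omega)), h g (hg.of_le (by norm_cast; omega))]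
  have key := VectorField.fderiv_apply_lieBracket (𝕜 := ℝ) (f := g) (x := a) (n := 2)
    (V := newtonOp e f α id) (W := newtonOp e f β id)
    ((hg.of_le (by norm_cast; omega)).contDiffAt) (by simp)
    (hFβ.differentiable (by norm_cast; omega) a) (hFα.differentiable (by norm_cast; omega) a)
  simp only [Pi.sub_apply]
  rw [← key, VectorField.lieBracket]

end NewtonOp

/-! ### The Newtonian map on the Banach tensor algebra -/

section Newton

variable {U : Type*} [NormedAddCommGroup U] [NormedSpace ℝ U] {𝒩 : TensorNorm U}
  {V : Type*} [NormedAddCommGroup V] [NormedSpace ℝ V] {I : Type*}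
  {e : Module.Basis I ℝ U} {f : I → V → V} {n : ℕ} {Λ : ℝ}

/-- The identification of the normed tensor algebra with the tensor algebra. -/
def toAlg : NTensor 𝒩 →ₗ[ℝ] TensorAlgebra ℝ U where
  toFun α := α
  map_add' _ _ := rfl
  map_smul' _ _ := rfl

theorem toAlg_mul (α β : NTensor 𝒩) : toAlg (α * β) = toAlg α * toAlg β := rfl

theorem toAlg_one : toAlg (1 : NTensor 𝒩) = 1 := rfl

theorem toAlg_nProj (k : ℕ) (α : NTensor 𝒩) : toAlg (nProj 𝒩 k α) = algProj U k (toAlg α) := rfl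

theorem toAlg_injective : Function.Injective (toAlg : NTensor 𝒩 → TensorAlgebra ℝ U) :=
  fun _ _ h => h

/-- The differential calculus of the vector fields `G · β`, with derivatives `D · β`. -/
structure NewtonCalculus (𝒩 : TensorNorm U) (n : ℕ) (Λ : ℝ) (G : V → BTensor 𝒩 →L[ℝ] V)
    (D : V → BTensor 𝒩 →L[ℝ] V →L[ℝ] V) : Prop where
  nonneg : 0 ≤ Λ
  hasFDerivAt : ∀ β a, HasFDerivAt (fun b => G b β) (D a β) a
  one : ∀ a, G a 1 = a
  sum_proj : ∀ a β, G a β = ∑ k ∈ Finset.range (n + 1), G a (proj 𝒩 k β)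
  norm_le : ∀ a k β, 1 ≤ k → k ≤ n → ‖G a (proj 𝒩 k β)‖ ≤ Λ * ‖proj 𝒩 k β‖
  norm_deriv_le : ∀ a k β, k ≤ n → ‖D a (proj 𝒩 k β)‖ ≤ Λ * ‖proj 𝒩 k β‖
  -- The product rule for `F†` combined with the derivation property of Lie elements, in the degrees
  -- where no truncation occurs.
  lie : ∀ a, ∀ l ∈ closedLie 𝒩, ∀ β j k, 1 ≤ j → j + k ≤ n →
    D a (proj 𝒩 k β) (G a (proj 𝒩 j l)) = G a (proj 𝒩 j l * proj 𝒩 k β)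

/-- A constant which bounds the vector fields `F[α]` and their Lipschitz constants in all degrees
from `1` to `n`. -/
structure NewtonConst (𝒩 : TensorNorm U) (e : Module.Basis I ℝ U) (f : I → V → V) (n : ℕ)
    (Λ : ℝ) : Prop where
  one_le : 1 ≤ Λ
  bound : ∀ k : ℕ, 1 ≤ k → k ≤ n → ∀ α : NTensor 𝒩, toAlg α ∈ homog U k →
    ∀ a, ‖newtonOp e f (toAlg α) id a‖ ≤ Λ * ‖α‖
  lip : ∀ k : ℕ, 1 ≤ k → k ≤ n → ∀ α : NTensor 𝒩, toAlg α ∈ homog U k →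
    ∀ a b, ‖newtonOp e f (toAlg α) id a - newtonOp e f (toAlg α) id b‖ ≤ Λ * ‖α‖ * ‖a - b‖

theorem NewtonBound.exists_const (h : NewtonBound 𝒩 e f n) : ∃ Λ, NewtonConst 𝒩 e f n Λ := by
  obtain ⟨ν, hν⟩ := h
  have hle : ∀ k ≤ n, ν k ≤ 1 + ∑ k ∈ Finset.range (n + 1), |ν k| := fun k hk =>
    (le_abs_self (ν k)).trans <| (Finset.single_le_sum (f := fun k => |ν k|)
      (fun _ _ => abs_nonneg _) (Finset.mem_range.2 (Nat.lt_succ_of_le hk))).trans (by simp)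
  -- The summand 1 makes the constant at least 1, so that it also serves in degree 0, where F[c] is
  -- multiplication by c.
  refine ⟨1 + ∑ k ∈ Finset.range (n + 1), |ν k|, ?_, ?_, ?_⟩
  · simpa using Finset.sum_nonneg fun _ _ => abs_nonneg _
  · intro k h1 hk α hα a
    exact ((hν k h1 hk α hα).1 a).trans (by gcongr; exact hle k hk)
  · intro k h1 hk α hα a b
    exact ((hν k h1 hk α hα).2 a b).trans (by gcongr; exact hle k hk)

/-- Degree 0 consists of scalars. The norm of 1 is not assumed to be 1, but submultiplicativity
forces it to be at least 1, whence the bound on c. -/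
theorem newtonOp_homog_zero {α : NTensor 𝒩} (hα : toAlg α ∈ homog U 0) :
    ∃ c : ℝ, |c| ≤ ‖α‖ ∧ newtonOp e f (toAlg α) id = fun a : V => c • a := by
  rw [homog, pow_zero, Submodule.mem_one] at hα
  obtain ⟨c, hc⟩ := hα
  have h1 : α = c • (1 : NTensor 𝒩) := toAlg_injective <| by
    rw [← hc, map_smul, toAlg_one, Algebra.algebraMap_eq_smul_one]
  refine ⟨c, ?_, ?_⟩
  · have h2 : (1 : NTensor 𝒩) ≠ 0 := one_ne_zero (α := TensorAlgebra ℝ U)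
    have h3 : 1 ≤ ‖(1 : NTensor 𝒩)‖ := by
      have h4 := norm_mul_le (1 : NTensor 𝒩) 1
      rw [mul_one] at h4
      have h5 := norm_pos_iff.2 h2
      by_contra h6
      nlinarith
    rw [h1, norm_smul, Real.norm_eq_abs]
    exact le_mul_of_one_le_right (abs_nonneg _) h3
  · rw [← hc, Algebra.algebraMap_eq_smul_one, newtonOp_smul, newtonOp_one]
    rfl

theorem NewtonConst.lip_homog (h : NewtonConst 𝒩 e f n Λ) {k : ℕ} (hk : k ≤ n) {α : NTensor 𝒩}
    (hα : toAlg α ∈ homog U k) (a b : V) :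
    ‖newtonOp e f (toAlg α) id a - newtonOp e f (toAlg α) id b‖ ≤ Λ * ‖α‖ * ‖a - b‖ := by
  rcases Nat.eq_zero_or_pos k with rfl | h1
  · obtain ⟨c, hc, h2⟩ := newtonOp_homog_zero (e := e) (f := f) hα
    rw [h2, ← smul_sub, norm_smul, Real.norm_eq_abs]
    have := le_mul_of_one_le_left (norm_nonneg α) h.one_le
    exact mul_le_mul_of_nonneg_right (hc.trans this) (norm_nonneg _)
  · exact h.lip k h1 hk α hα a b

/-- The dependence on a comes from degree 0 only, since the identity map is unbounded. -/
theorem NewtonConst.norm_homog_le (h : NewtonConst 𝒩 e f n Λ) {k : ℕ} (hk : k ≤ n)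
    {α : NTensor 𝒩} (hα : toAlg α ∈ homog U k) (a : V) :
    ‖newtonOp e f (toAlg α) id a‖ ≤ (Λ + ‖a‖) * ‖α‖ := by
  have h0 := h.one_le
  rcases Nat.eq_zero_or_pos k with rfl | h1
  · obtain ⟨c, hc, h2⟩ := newtonOp_homog_zero (e := e) (f := f) hα
    rw [h2, norm_smul, Real.norm_eq_abs, mul_comm]
    have : ‖a‖ ≤ Λ + ‖a‖ := by linarith
    exact mul_le_mul this hc (abs_nonneg _) (by positivity)
  · refine (h.bound k h1 hk α hα a).trans ?_
    have := norm_nonneg a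
    gcongr
    linarith

theorem newtonOp_algTrunc (α : TensorAlgebra ℝ U) (g : V → V) :
    newtonOp e f (algTrunc U n α) g =
      ∑ k ∈ Finset.range (n + 1), newtonOp e f (algProj U k α) g := by
  rw [← newtonLin_apply, algTrunc, map_sum]; rfl

theorem differentiable_newtonOp_homog (hf : ∀ i, ContDiff ℝ n (f i)) {k : ℕ} (hk : k ≤ n)
    {α : TensorAlgebra ℝ U} (hα : α ∈ homog U k) :
    Differentiable ℝ (newtonOp e f α id : V → V) :=
  (contDiff_newtonOp hf (m := 1) (k := k) (by omega) contDiff_id hα).differentiable (by norm_num)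

theorem differentiable_newtonOp_algTrunc (hf : ∀ i, ContDiff ℝ n (f i)) (α : TensorAlgebra ℝ U) :
    Differentiable ℝ (newtonOp e f (algTrunc U n α) id : V → V) := by
  rw [newtonOp_algTrunc]
  refine Differentiable.sum fun k hk => ?_
  exact differentiable_newtonOp_homog hf (by have := Finset.mem_range.1 hk; omega)
    (algProj_mem k α)

theorem NewtonConst.norm_algTrunc_le (h : NewtonConst 𝒩 e f n Λ) (α : NTensor 𝒩) (a : V) :
    ‖newtonOp e f (algTrunc U n (toAlg α)) id a‖ ≤ (n + 1) * (Λ + ‖a‖) * ‖α‖ := by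
  have h0 := h.one_le
  have := norm_nonneg a
  rw [newtonOp_algTrunc, Finset.sum_apply]
  calc _ ≤ ∑ k ∈ Finset.range (n + 1), (Λ + ‖a‖) * ‖α‖ := by
        refine norm_sum_le_of_le _ fun k hk => ?_
        refine (h.norm_homog_le (α := nProj 𝒩 k α) (by have := Finset.mem_range.1 hk; omega)
          (algProj_mem k _) a).trans ?_
        have := norm_nProj_le (𝒩 := 𝒩) k α
        gcongr
    _ = _ := by simp; ring

theorem NewtonConst.lip_algTrunc (h : NewtonConst 𝒩 e f n Λ) (α : NTensor 𝒩) (a b : V) :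
    ‖newtonOp e f (algTrunc U n (toAlg α)) id a - newtonOp e f (algTrunc U n (toAlg α)) id b‖ ≤
      (n + 1) * Λ * ‖α‖ * ‖a - b‖ := by
  have h0 := h.one_le
  rw [newtonOp_algTrunc, Finset.sum_apply, Finset.sum_apply, ← Finset.sum_sub_distrib]
  calc _ ≤ ∑ k ∈ Finset.range (n + 1), Λ * ‖α‖ * ‖a - b‖ := by
        refine norm_sum_le_of_le _ fun k hk => ?_
        refine (h.lip_homog (α := nProj 𝒩 k α) (by have := Finset.mem_range.1 hk; omega)
          (algProj_mem k _) a b).trans ?_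
        have := norm_nProj_le (𝒩 := 𝒩) k α
        gcongr
    _ = _ := by simp; ring

/-- Evaluation of `F[α⁽≤ⁿ⁾]` at `a`, as a continuous linear function of `α`. -/
def NewtonConst.eval (h : NewtonConst 𝒩 e f n Λ) (a : V) : NTensor 𝒩 →L[ℝ] V :=
  LinearMap.mkContinuous (E := NTensor 𝒩)
    { toFun := fun α => newtonOp e f (algTrunc U n (toAlg α)) id a
      map_add' := fun α β => by
        rw [newtonOp_algTrunc, newtonOp_algTrunc, newtonOp_algTrunc]
        simp only [map_add, newtonOp_add, Finset.sum_add_distrib, Pi.add_apply]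
      map_smul' := fun c α => by
        rw [newtonOp_algTrunc, newtonOp_algTrunc]
        simp only [map_smul, newtonOp_smul, ← Finset.smul_sum, Pi.smul_apply, RingHom.id_apply] }
    ((n + 1) * (Λ + ‖a‖)) (fun α => h.norm_algTrunc_le α a)

theorem NewtonConst.eval_apply (h : NewtonConst 𝒩 e f n Λ) (a : V) (α : NTensor 𝒩) :
    h.eval a α = newtonOp e f (algTrunc U n (toAlg α)) id a := rfl

theorem NewtonConst.hasFDerivAt_eval (h : NewtonConst 𝒩 e f n Λ)
    (hf : ∀ i, ContDiff ℝ n (f i)) (a : V) (α : NTensor 𝒩) :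
    HasFDerivAt (fun b => h.eval b α) (fderiv ℝ (fun b => h.eval b α) a) a :=
  (differentiable_newtonOp_algTrunc hf α a).hasFDerivAt

theorem NewtonConst.norm_fderiv_eval_le (h : NewtonConst 𝒩 e f n Λ) (a : V) (α : NTensor 𝒩) :
    ‖fderiv ℝ (fun b => h.eval b α) a‖ ≤ (n + 1) * Λ * ‖α‖ := by
  have := h.one_le
  exact norm_fderiv_le_of_lip' ℝ (by positivity) (.of_forall fun b => h.lip_algTrunc α b a)

/-- The derivative of `F[α⁽≤ⁿ⁾]` at `a`, as a continuous linear function of `α`. -/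
def NewtonConst.deriv (h : NewtonConst 𝒩 e f n Λ) (hf : ∀ i, ContDiff ℝ n (f i)) (a : V) :
    NTensor 𝒩 →L[ℝ] V →L[ℝ] V :=
  LinearMap.mkContinuous (E := NTensor 𝒩)
    { toFun := fun α => fderiv ℝ (fun b => h.eval b α) a
      map_add' := fun α β => by
        simp only [map_add]
        exact ((h.hasFDerivAt_eval hf a α).add (h.hasFDerivAt_eval hf a β)).fderiv
      map_smul' := fun c α => by
        simp only [map_smul]
        exact ((h.hasFDerivAt_eval hf a α).const_smul c).fderiv }
    ((n + 1) * Λ) (fun α => h.norm_fderiv_eval_le a α)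

theorem NewtonConst.eval_nProj (h : NewtonConst 𝒩 e f n Λ) {k : ℕ} (hk : k ≤ n) (α : NTensor 𝒩)
    (a : V) : h.eval a (nProj 𝒩 k α) = newtonOp e f (algProj U k (toAlg α)) id a := by
  rw [h.eval_apply, toAlg_nProj, newtonOp_algTrunc, Finset.sum_apply,
    Finset.sum_eq_single_of_mem k (Finset.mem_range.2 (by omega)),
    algProj_algProj, if_pos rfl]
  intro b _ hb
  rw [algProj_algProj, if_neg hb.symm, newtonOp_zero, Pi.zero_apply]

/-- A tensor without constant term, each of whose components acts on functions as a derivation. -/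
def IsPrimitive (e : Module.Basis I ℝ U) (f : I → V → V) (n : ℕ) (α : TensorAlgebra ℝ U) : Prop :=
  algProj U 0 α = 0 ∧ ∀ k, 1 ≤ k → k ≤ n → IsDerivation e f k (algProj U k α)

theorem IsPrimitive.lie (hf : ∀ i, ContDiff ℝ n (f i)) {α β : TensorAlgebra ℝ U}
    (h : IsPrimitive e f n α) (h' : IsPrimitive e f n β) :
    IsPrimitive e f n (α * β - β * α) := by
  have key : ∀ k, algProj U k (α * β - β * α) = ∑ q ∈ Finset.HasAntidiagonal.antidiagonal k,
      (algProj U q.1 α * algProj U q.2 β - algProj U q.2 β * algProj U q.1 α) := by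
    intro k
    rw [map_sub, algProj_mul, algProj_mul, Finset.sum_sub_distrib,
      -- Exchanging the two degrees in the second product groups the sum into commutators of
      -- homogeneous components.
      ← Finset.Nat.sum_antidiagonal_swap (f := fun q => algProj U q.1 β * algProj U q.2 α)]
    rfl
  refine ⟨?_, fun k h1 hk => ?_⟩
  · rw [key]
    simp [h.1, h'.1]
  · rw [key]
    refine IsDerivation.sum _ fun q hq => ?_
    have hq := Finset.HasAntidiagonal.mem_antidiagonal.1 hq
    rcases Nat.eq_zero_or_pos q.1 with h0 | h0
    · rw [h0, h.1, zero_mul, mul_zero, sub_zero]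
      exact IsDerivation.zero k
    rcases Nat.eq_zero_or_pos q.2 with h2 | h2
    · rw [h2, h'.1, zero_mul, mul_zero, sub_zero]
      exact IsDerivation.zero k
    rw [← hq]
    exact IsDerivation.lie hf h0 h2 (by omega) (algProj_mem _ _) (algProj_mem _ _)
      (h.2 _ h0 (by omega)) (h'.2 _ h2 (by omega))

/-- Before closure the Lie algebra already lies in the algebraic tensor algebra, where `F†` acts on
functions. Statements about the closed Lie algebra are then obtained by continuity. -/
theorem lieSpan_subset_primitive (hf : ∀ i, ContDiff ℝ n (f i)) {l : BTensor 𝒩}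
    (hl : l ∈ LieSubalgebra.lieSpan ℝ (BTensor 𝒩)
      (range fun u : U => Completion.coe' (α := NTensor 𝒩) (TensorAlgebra.ι ℝ u))) :
    ∃ α : NTensor 𝒩, coeL 𝒩 α = l ∧ IsPrimitive e f n (toAlg α) := by
  induction hl using LieSubalgebra.lieSpan_induction with
  | mem x hx =>
    obtain ⟨u, rfl⟩ := hx
    refine ⟨TensorAlgebra.ι ℝ u, rfl, ?_⟩
    change IsPrimitive e f n (TensorAlgebra.ι ℝ u)
    have hu : TensorAlgebra.ι ℝ u ∈ homog U 1 := by
      rw [homog, pow_one]; exact LinearMap.mem_range_self _ _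
    refine ⟨by rw [algProj_of_mem hu, if_neg one_ne_zero], fun k _ _ => ?_⟩
    rw [algProj_of_mem hu]
    split_ifs
    · exact isDerivation_of_mem_one hu
    · exact IsDerivation.zero k
  | zero =>
    refine ⟨0, map_zero _, by rw [map_zero, map_zero], fun k _ _ => ?_⟩
    rw [map_zero, map_zero]
    exact IsDerivation.zero k
  | add x y _ _ hx hy =>
    obtain ⟨α, rfl, hα⟩ := hx
    obtain ⟨β, rfl, hβ⟩ := hy
    refine ⟨α + β, map_add _ _ _, by rw [map_add, map_add, hα.1, hβ.1, add_zero],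
      fun k h1 hk => ?_⟩
    rw [map_add, map_add]
    exact (hα.2 k h1 hk).add (hβ.2 k h1 hk)
  | smul c x _ hx =>
    obtain ⟨α, rfl, hα⟩ := hx
    refine ⟨c • α, map_smul _ _ _, by rw [map_smul, map_smul, hα.1, smul_zero],
      fun k h1 hk => ?_⟩
    rw [map_smul, map_smul]
    exact (hα.2 k h1 hk).smul c
  | lie x y _ _ hx hy =>
    obtain ⟨α, rfl, hα⟩ := hx
    obtain ⟨β, rfl, hβ⟩ := hy
    refine ⟨α * β - β * α, ?_, ?_⟩
    · rw [map_sub, coeL_mul, coeL_mul]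
      rfl
    · rw [map_sub, toAlg_mul, toAlg_mul]
      exact IsPrimitive.lie hf hα hβ

theorem isUniformInducing_coeL : IsUniformInducing (coeL 𝒩) :=
  Completion.isUniformInducing_coe (NTensor 𝒩)

theorem proj_zero_of_mem_closedLie {l : BTensor 𝒩} (hl : l ∈ closedLie 𝒩) : proj 𝒩 0 l = 0 := by
  have hcl : IsClosed {l : BTensor 𝒩 | proj 𝒩 0 l = 0} := isClosed_eq (by fun_prop) (by fun_prop)
  refine hcl.closure_subset_iff.2 (fun l hl => ?_) hl
  -- Only the vanishing of the degree 0 component matters here, so trivial data serve: zero vector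
  -- fields and n = 0.
  obtain ⟨α, rfl, hα⟩ := lieSpan_subset_primitive (V := U) (e := Module.Basis.ofVectorSpace ℝ U)
    (f := fun _ => 0) (n := 0) (fun _ => contDiff_const) hl
  rw [mem_ofPred_eq, proj_coeL]
  have : nProj 𝒩 0 α = 0 := hα.1
  rw [this, map_zero]

/-- The Newtonian map is given by a differential calculus. -/
theorem NewtonConst.exists_calculus [CompleteSpace V] (h : NewtonConst 𝒩 e f n Λ)
    (hf : ∀ i, ContDiff ℝ n (f i)) :
    ∃ (G : V → BTensor 𝒩 →L[ℝ] V) (D : V → BTensor 𝒩 →L[ℝ] V →L[ℝ] V),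
      (∀ β a, newtonMap 𝒩 e f n β a = G a β) ∧ NewtonCalculus 𝒩 n Λ G D := by
  have hΛ := h.one_le
  set G : V → BTensor 𝒩 →L[ℝ] V := fun a => (h.eval a).extend (coeL 𝒩) with hG
  set D : V → BTensor 𝒩 →L[ℝ] V →L[ℝ] V := fun a => (h.deriv hf a).extend (coeL 𝒩) with hD
  have hGc : ∀ a α, G a (coeL 𝒩 α) = h.eval a α := fun a α =>
    ContinuousLinearMap.extend_eq _ denseRange_coeL isUniformInducing_coeL α
  have hDc : ∀ a α, D a (coeL 𝒩 α) = fderiv ℝ (fun b => h.eval b α) a := fun a α =>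
    ContinuousLinearMap.extend_eq _ denseRange_coeL isUniformInducing_coeL α
  have hGlip : ∀ β a b, ‖G a β - G b β‖ ≤ (n + 1) * Λ * ‖β‖ * ‖a - b‖ := by
    intro β a b
    induction β using denseRange_coeL.induction_on with
    | hp => exact isClosed_le (by fun_prop) (by fun_prop)
    | ih α => rw [hGc, hGc, norm_coeL]; exact h.lip_algTrunc α a b
  have hDn : ∀ β a, ‖D a β‖ ≤ (n + 1) * Λ * ‖β‖ := by
    intro β a
    induction β using denseRange_coeL.induction_on with
    | hp => exact isClosed_le (by fun_prop) (by fun_prop)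
    | ih α => rw [hDc, norm_coeL]; exact h.norm_fderiv_eval_le a α
  refine ⟨G, D, ?_, ?_, ?_, ?_, ?_, ?_, ?_, ?_⟩
  · intro β a
    refine congrFun (Completion.extension_unique (h.eval a).uniformContinuous
      (G a).uniformContinuous fun α => (hGc a α).symm) β
  · linarith
  · intro β a
    rw [hasFDerivAt_iff_isLittleO, Asymptotics.isLittleO_iff]
    intro c hc
    set K : ℝ := (n + 1) * Λ with hK
    have hKpos : 0 < K := by positivity
    -- Differentiability passes to the limit because the Lipschitz bound is uniform in the tensor:
    -- replacing β by α costs c/4 in the increment and c/4 in the derivative, and the remainder for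
    -- α takes the other c/2.
    obtain ⟨α, hα⟩ := denseRange_coeL.exists_dist_lt β (ε := c / (4 * K)) (by positivity)
    have h1 := (hasFDerivAt_iff_isLittleO.1 (h.hasFDerivAt_eval hf a α))
    rw [Asymptotics.isLittleO_iff] at h1
    filter_upwards [h1 (half_pos hc)] with b hb
    rw [← hDc, ← hGc, ← hGc] at hb
    have h2 := hGlip (β - coeL 𝒩 α) b a
    have h3 := (D a (β - coeL 𝒩 α)).le_of_opNorm_le (hDn (β - coeL 𝒩 α) a) (b - a)
    have h4 : K * ‖β - coeL 𝒩 α‖ ≤ c / 4 := by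
      rw [← dist_eq_norm]
      calc _ ≤ K * (c / (4 * K)) := by gcongr
        _ = c / 4 := by field_simp
    have h5 : G b β - G a β - (D a β) (b - a) =
        (G b (β - coeL 𝒩 α) - G a (β - coeL 𝒩 α)) - D a (β - coeL 𝒩 α) (b - a) +
          (G b (coeL 𝒩 α) - G a (coeL 𝒩 α) - D a (coeL 𝒩 α) (b - a)) := by
      simp only [map_sub, sub_apply]
      abel
    rw [h5]
    refine (norm_add_le _ _).trans ((add_le_add (norm_sub_le _ _) hb).trans ?_)
    have h6 := mul_le_mul_of_nonneg_right h4 (norm_nonneg (b - a))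
    linarith
  · intro a
    rw [← coeL_one, hGc]
    have h1 : nProj 𝒩 0 1 = 1 := algProj_one 0
    rw [← h1, h.eval_nProj (Nat.zero_le n), toAlg_one, algProj_one, if_pos rfl, newtonOp_one]
    rfl
  · intro a β
    induction β using denseRange_coeL.induction_on with
    | hp =>
      exact isClosed_eq (by fun_prop) (continuous_finsetSum _ fun _ _ => by fun_prop)
    | ih α =>
      rw [hGc, h.eval_apply, newtonOp_algTrunc, Finset.sum_apply]
      refine Finset.sum_congr rfl fun k hk => ?_
      rw [proj_coeL, hGc, h.eval_nProj (by have := Finset.mem_range.1 hk; omega)]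
  · intro a k β h1 hk
    induction β using denseRange_coeL.induction_on with
    | hp => exact isClosed_le (by fun_prop) (by fun_prop)
    | ih α =>
      rw [proj_coeL, hGc, h.eval_nProj hk, norm_coeL]
      exact h.bound k h1 hk (nProj 𝒩 k α) (algProj_mem k _) a
  · intro a k β hk
    induction β using denseRange_coeL.induction_on with
    | hp => exact isClosed_le (by fun_prop) (by fun_prop)
    | ih α =>
      rw [proj_coeL, hDc, norm_coeL]
      refine norm_fderiv_le_of_lip' ℝ (by positivity) (.of_forall fun b => ?_)
      rw [h.eval_nProj hk, h.eval_nProj hk]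
      exact h.lip_homog hk (α := nProj 𝒩 k α) (algProj_mem k _) b a
  · intro a l hl β j k hj hjk
    induction β using denseRange_coeL.induction_on with
    | hp => exact isClosed_eq (by fun_prop) (by fun_prop)
    | ih β =>
      -- Both sides are continuous in l, so it suffices to treat the Lie algebra before closure.
      have hcl : IsClosed {l : BTensor 𝒩 | D a (proj 𝒩 k (coeL 𝒩 β)) (G a (proj 𝒩 j l)) =
          G a (proj 𝒩 j l * proj 𝒩 k (coeL 𝒩 β))} := isClosed_eq (by fun_prop) (by fun_prop)
      refine hcl.closure_subset_iff.2 (fun l hl => ?_) hl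
      obtain ⟨α, rfl, hα⟩ := lieSpan_subset_primitive (e := e) hf hl
      have hm : toAlg (nProj 𝒩 j α * nProj 𝒩 k β) ∈ homog U (j + k) := by
        rw [homog, pow_add]
        exact Submodule.mul_mem_mul (algProj_mem _ _) (algProj_mem _ _)
      have hm' : nProj 𝒩 (j + k) (nProj 𝒩 j α * nProj 𝒩 k β) = nProj 𝒩 j α * nProj 𝒩 k β :=
        toAlg_injective <| by rw [toAlg_nProj, algProj_of_mem hm, if_pos rfl]
      -- The product is written as its own component of degree j + k ≤ n, so that the truncation in
      -- the evaluation disappears.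
      rw [mem_ofPred_eq, proj_coeL, proj_coeL, ← coeL_mul, hGc, hGc, hDc, ← hm',
        h.eval_nProj hjk, algProj_of_mem hm, if_pos rfl]
      simp only [h.eval_nProj (show k ≤ n by omega), h.eval_nProj (show j ≤ n by omega)]
      rw [toAlg_mul, toAlg_nProj, toAlg_nProj,
        newtonOp_mul (i := j) (j := k) hf (by omega) contDiff_id (algProj_mem _ _)
          (algProj_mem _ _),
        hα.2 j hj (by omega) _ (contDiff_newtonOp hf (by omega) contDiff_id (algProj_mem _ _))]

end Newton

open Polynomial in
/-- The truncated exponential of the truncated logarithm of `1 + X` is `1 + X`, up to degree `n`. -/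
theorem X_pow_dvd_exp_log (n : ℕ) :
    (X : ℝ[X]) ^ (n + 1) ∣
      (∑ m ∈ Finset.range (n + 1), ((m.factorial : ℝ)⁻¹) •
        (∑ k ∈ Finset.Icc 1 n, ((-1 : ℝ) ^ (k + 1) / (k : ℝ)) • (X : ℝ[X]) ^ k) ^ m) - (1 + X) := by
  set L : ℝ[X] := ∑ k ∈ Finset.Icc 1 n, ((-1 : ℝ) ^ (k + 1) / (k : ℝ)) • (X : ℝ[X]) ^ k with hL
  set P : ℝ[X] := ∑ m ∈ Finset.range (n + 1), ((m.factorial : ℝ)⁻¹) • L ^ m with hP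
  have hXL : X ∣ L := Finset.dvd_sum fun k hk =>
    by
    rw [smul_eq_C_mul]
    exact (dvd_pow_self _ (by have := (Finset.mem_Icc.1 hk).1; omega)).mul_left _
  have hL' : (1 + X) * derivative L = 1 - (-X) ^ n := by
    have h1 : derivative L = ∑ k ∈ Finset.range n, (-X : ℝ[X]) ^ k := by
      rw [hL, map_sum, ← Finset.Ico_add_one_right_eq_Icc, Finset.sum_Ico_eq_sum_range]
      refine Finset.sum_congr (by simp) fun k _ => ?_
      rw [derivative_smul, derivative_X_pow, neg_pow (X : ℝ[X]) k, smul_eq_C_mul]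
      have h2 : ((1 + k : ℕ) : ℝ) ≠ 0 := by positivity
      rw [show 1 + k - 1 = k by omega, ← mul_assoc, ← C_mul, div_mul_cancel₀ _ h2,
        show 1 + k + 1 = k + 2 by omega, pow_add]
      simp
    have h2 := mul_neg_geom_sum (-X : ℝ[X]) n
    rw [sub_neg_eq_add] at h2
    rw [h1, h2]
  -- Differentiating the truncated exponential loses its last term, which is a multiple of Xⁿ
  -- because X divides L.
  have hP' : derivative P = derivative L * (P - ((n.factorial : ℝ)⁻¹) • L ^ n) := by
    rw [hP, Finset.sum_range_succ, add_sub_cancel_right, ← Finset.sum_range_succ,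
      Finset.sum_range_succ', map_add, map_sum, Finset.mul_sum]
    simp only [pow_zero, derivative_smul, derivative_one, smul_zero, add_zero]
    refine Finset.sum_congr rfl fun m _ => ?_
    rw [derivative_pow_succ, Nat.factorial_succ, smul_eq_C_mul, smul_eq_C_mul]
    have h2 : ((m + 1 : ℕ) : ℝ) ≠ 0 := by positivity
    have h3 : (((m + 1) * m.factorial : ℕ) : ℝ)⁻¹ * ((m : ℝ) + 1) = (m.factorial : ℝ)⁻¹ := by
      push_cast at h2 ⊢
      field_simp
    rw [← h3, C_mul]
    simp only [map_add, map_natCast, map_one]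
    ring
  -- The defect satisfies (1 + X) Q' ≡ Q modulo Xⁿ, as 1 + X solves that equation exactly. The
  -- resulting recursion on coefficients, started from Q(0) = 0, annihilates all degrees up to n.
  set Q := P - (1 + X) with hQ
  have hmod : X ^ n ∣ (1 + X) * derivative Q - Q := by
    have h1 : (1 + X) * derivative Q - Q =
        (-(-X) ^ n) * (P - ((n.factorial : ℝ)⁻¹) • L ^ n) - ((n.factorial : ℝ)⁻¹) • L ^ n := by
      rw [hQ, derivative_sub, hP']
      simp only [derivative_add, derivative_one, derivative_X, zero_add]
      linear_combination (P - ((n.factorial : ℝ)⁻¹) • L ^ n) * hL'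
    rw [h1]
    refine dvd_sub (Dvd.dvd.mul_right ?_ _) (by
      rw [smul_eq_C_mul]
      exact (pow_dvd_pow_of_dvd hXL n).mul_left _)
    rw [dvd_neg, neg_pow]
    exact Dvd.intro_left _ rfl
  have hco : ∀ k < n, ((k : ℝ) + 1) * Q.coeff (k + 1) = (1 - k) * Q.coeff k := by
    intro k hk
    have h1 := X_pow_dvd_iff.1 hmod k hk
    rw [coeff_sub, add_mul, one_mul, coeff_add, coeff_derivative] at h1
    have h2 : (X * derivative Q).coeff k = k * Q.coeff k := by
      cases k with
      | zero => simp
      | succ k => rw [coeff_X_mul, coeff_derivative]; push_cast; ring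
    rw [h2] at h1
    linarith
  have h0 : Q.coeff 0 = 0 := by
    have hL0 : L.eval 0 = 0 := by
      obtain ⟨R, hR⟩ := hXL
      rw [hR]; simp
    rw [coeff_zero_eq_eval_zero, hQ, hP, eval_sub, eval_finsetSum,
      Finset.sum_eq_single_of_mem 0 (by simp)]
    · simp
    · intro m _ hm
      simp [hL0, hm]
  rw [X_pow_dvd_iff]
  intro k
  induction k with
  | zero => exact fun _ => h0
  | succ k ih =>
    intro hk
    have h1 := hco k (by omega)
    rw [ih (by omega), mul_zero] at h1
    exact (mul_eq_zero.1 h1).resolve_left (by positivity)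

/-! ### Exponential and logarithm in the truncated algebra -/

section ExpLog

variable {U : Type*} [NormedAddCommGroup U] [NormedSpace ℝ U] {𝒩 : TensorNorm U} {n : ℕ}

/-- The polynomial identity is evaluated at x - 1: this element has no constant term, so its power n
+ 1 is invisible up to degree n. -/
theorem exp_logTrunc {x : BTensor 𝒩} (hx : proj 𝒩 0 x = 1) :
    TruncEq n (∑ m ∈ Finset.range (n + 1), ((m.factorial : ℝ)⁻¹) • logTrunc 𝒩 n x ^ m) x := by
  have h0 : proj 𝒩 0 (x - 1) = 0 := by rw [map_sub, hx, proj_one, if_pos rfl, sub_self]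
  refine (TruncEq.sum_smul _ _ fun m _ => (truncEq_trunc n _).pow m).trans ?_
  obtain ⟨q, hq⟩ := X_pow_dvd_exp_log n
  have h1 := congrArg (Polynomial.aeval (x - 1)) hq
  simp only [map_sub, map_sum, map_smul, map_pow, Polynomial.aeval_X, map_add, map_one,
    map_mul] at h1
  have h2 : (1 : BTensor 𝒩) + (x - 1) = x := by abel
  rw [h2, sub_eq_iff_eq_add] at h1
  rw [h1]
  intro k hk
  rw [map_add, proj_mul, Finset.sum_eq_zero, zero_add]
  intro r hr
  have := Finset.HasAntidiagonal.mem_antidiagonal.1 hr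
  rw [proj_pow_eq_zero h0 (by omega), zero_mul]

theorem btensor_smul_mul (c : ℝ) (α β : BTensor 𝒩) : c • α * β = c • (α * β) :=
  Algebra.smul_mul_assoc c α β

theorem scaled_one (𝒩 : TensorNorm U) (n : ℕ) {ε : ℝ} (h0 : 0 ≤ ε) : Scaled n ε ‖(1 : BTensor 𝒩)‖ (1 : BTensor 𝒩) := by
  intro k _
  rw [proj_one]
  split_ifs with h
  · simp [h]
  · rw [norm_zero]; positivity

theorem exists_scaled_logTrunc (𝒩 : TensorNorm U) (n : ℕ) (M : ℝ) :
    ∃ M', ∀ ε (x : BTensor 𝒩), 0 ≤ ε → Scaled n ε M x → proj 𝒩 0 x = 1 →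
      Scaled n ε M' (logTrunc 𝒩 n x) := by
  refine ⟨∑ k ∈ Finset.Icc 1 n, |(-1 : ℝ) ^ (k + 1) / (k : ℝ)| *
    (((n + 1) * M) ^ k * ‖(1 : BTensor 𝒩)‖), fun ε x h0 hM hx => ?_⟩
  have h1 : Scaled n ε M (x - 1) := by
    intro k hk
    rw [map_sub, proj_one]
    split_ifs with h
    · rw [h, hx, sub_self, norm_zero, pow_zero, mul_one]
      exact hM.nonneg
    · rw [sub_zero]; exact hM k hk
  refine Scaled.congr (Scaled.sum_smul _ _ fun k _ => ?_) (truncEq_trunc n _).symm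
  have := h1.pow_mul (scaled_one 𝒩 n h0) h0 k
  rwa [mul_one] at this

end ExpLog

/-! ### Expansion along the flow of a Lie element -/

section Expansion

variable {U : Type*} [NormedAddCommGroup U] [NormedSpace ℝ U] {𝒩 : TensorNorm U}
  {V : Type*} [NormedAddCommGroup V] [NormedSpace ℝ V] {n : ℕ} {Λ : ℝ}
  {G : V → BTensor 𝒩 →L[ℝ] V} {D : V → BTensor 𝒩 →L[ℝ] V →L[ℝ] V} {ε E M M' : ℝ}

namespace NewtonCalculus

variable (h : NewtonCalculus 𝒩 n Λ G D)

include h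

theorem congr (a : V) {β γ : BTensor 𝒩} (hβ : TruncEq n β γ) : G a β = G a γ := by
  rw [h.sum_proj a β, h.sum_proj a γ]
  exact Finset.sum_congr rfl fun k hk => by rw [hβ k (by have := Finset.mem_range.1 hk; omega)]

theorem deriv_sum_proj (a : V) (β : BTensor 𝒩) :
    D a β = ∑ k ∈ Finset.range (n + 1), D a (proj 𝒩 k β) := by
  refine (h.hasFDerivAt β a).unique ?_
  have : (fun b => G b β) = fun b => ∑ k ∈ Finset.range (n + 1), G b (proj 𝒩 k β) :=
    funext fun b => h.sum_proj b β
  rw [this]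
  exact HasFDerivAt.fun_sum fun k _ => h.hasFDerivAt _ a

theorem norm_le_sum (a : V) {l : BTensor 𝒩} (hl : proj 𝒩 0 l = 0) :
    ‖G a l‖ ≤ ∑ k ∈ Finset.Icc 1 n, Λ * ‖proj 𝒩 k l‖ := by
  rw [h.sum_proj, Finset.sum_range_succ', hl, map_zero, add_zero,
    ← Finset.Ico_add_one_right_eq_Icc, Finset.sum_Ico_eq_sum_range, add_tsub_cancel_right]
  refine norm_sum_le_of_le _ fun k hk => ?_
  rw [add_comm 1 k]
  exact h.norm_le a (k + 1) l (by omega) (by have := Finset.mem_range.1 hk; omega)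

theorem norm_deriv_le_sum (a : V) {l : BTensor 𝒩} (hl : proj 𝒩 0 l = 0) :
    ‖D a l‖ ≤ ∑ k ∈ Finset.Icc 1 n, Λ * ‖proj 𝒩 k l‖ := by
  rw [h.deriv_sum_proj, Finset.sum_range_succ', hl, map_zero, add_zero,
    ← Finset.Ico_add_one_right_eq_Icc, Finset.sum_Ico_eq_sum_range, add_tsub_cancel_right]
  refine norm_sum_le_of_le _ fun k hk => ?_
  rw [add_comm 1 k]
  exact h.norm_deriv_le a (k + 1) l (by have := Finset.mem_range.1 hk; omega)

/-- Without the degree 0 term, every component carries at least one factor ε; the remaining powers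
are absorbed by (1 + E)ⁿ. -/
theorem sum_norm_proj_le {l : BTensor 𝒩} (h0 : 0 ≤ ε) (hE : ε ≤ E) (hs : Scaled n ε M l) :
    ∑ k ∈ Finset.Icc 1 n, Λ * ‖proj 𝒩 k l‖ ≤ n * Λ * M * (1 + E) ^ n * ε := by
  have hΛ := h.nonneg
  have hM := hs.nonneg
  calc _ ≤ ∑ k ∈ Finset.Icc 1 n, Λ * (M * ((1 + E) ^ n * ε)) := by
        refine Finset.sum_le_sum fun k hk => ?_
        obtain ⟨h1, hk⟩ := Finset.mem_Icc.1 hk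
        refine mul_le_mul_of_nonneg_left ((hs k hk).trans ?_) hΛ
        refine mul_le_mul_of_nonneg_left ?_ hM
        obtain ⟨j, rfl⟩ := Nat.exists_eq_add_of_le' h1
        rw [pow_succ]
        refine mul_le_mul_of_nonneg_right ?_ h0
        calc ε ^ j ≤ (1 + E) ^ j := pow_le_pow_left₀ h0 (by linarith) j
          _ ≤ (1 + E) ^ n := pow_le_pow_right₀ (by linarith) (by omega)
    _ = _ := by simp; ring

theorem lipschitz {l : BTensor 𝒩} (hl : proj 𝒩 0 l = 0) :
    LipschitzWith (∑ k ∈ Finset.Icc 1 n, Λ * ‖proj 𝒩 k l‖).toNNReal (fun a => G a l) := by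
  have h0 : 0 ≤ ∑ k ∈ Finset.Icc 1 n, Λ * ‖proj 𝒩 k l‖ :=
    Finset.sum_nonneg fun k _ => mul_nonneg h.nonneg (norm_nonneg _)
  refine LipschitzWith.of_dist_le_mul fun a b => ?_
  rw [Real.coe_toNNReal _ h0, dist_eq_norm, dist_eq_norm]
  exact Convex.norm_image_sub_le_of_norm_hasFDerivWithin_le (s := univ)
    (fun a _ => (h.hasFDerivAt l a).hasFDerivWithinAt) (fun a _ => h.norm_deriv_le_sum a hl)
    convex_univ (mem_univ b) (mem_univ a)

/-- Up to terms of degree greater than `n`, differentiating `F[β]` in the direction `F[l]` amounts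
to multiplying `β` by the Lie element `l`. -/
theorem norm_deriv_sub_le {l β : BTensor 𝒩} (hl : l ∈ closedLie 𝒩) (h0 : 0 ≤ ε) (hE : ε ≤ E)
    (hs : Scaled n ε M l) (hs' : Scaled n ε M' β) (a : V) :
    ‖D a β (G a l) - G a (l * β)‖ ≤
      (n + 1) ^ 2 * (Λ ^ 2 * M * M' * (1 + E) ^ n) * ε ^ (n + 1) := by
  have hΛ := h.nonneg
  have hM := hs.nonneg
  have hM' := hs'.nonneg
  have h1 : G a (l * β) = ∑ j ∈ Finset.range (n + 1), ∑ k ∈ Finset.range (n + 1),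
      G a (proj 𝒩 j l * proj 𝒩 k β) := by
    rw [h.congr a ((truncEq_trunc n l).mul (truncEq_trunc n β)).symm, trunc, trunc,
      Finset.sum_mul_sum, map_sum]
    simp only [map_sum]
  have h2 : D a β (G a l) = ∑ j ∈ Finset.range (n + 1), ∑ k ∈ Finset.range (n + 1),
      D a (proj 𝒩 k β) (G a (proj 𝒩 j l)) := by
    rw [h.sum_proj a l, map_sum]
    refine Finset.sum_congr rfl fun j _ => ?_
    rw [h.deriv_sum_proj a β, sum_apply]
  rw [h1, h2, ← Finset.sum_sub_distrib]
  simp only [← Finset.sum_sub_distrib]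
  calc _ ≤ ∑ j ∈ Finset.range (n + 1), ∑ k ∈ Finset.range (n + 1),
        (Λ ^ 2 * M * M' * (1 + E) ^ n) * ε ^ (n + 1) := by
        refine norm_sum_le_of_le _ fun j hj => norm_sum_le_of_le _ fun k hk => ?_
        have hj := Finset.mem_range.1 hj
        have hk := Finset.mem_range.1 hk
        -- If j + k > n, the product is truncated away and the other term alone is of order ε^{j+k};
        -- here j ≥ 1 because k ≤ n. If j + k ≤ n, the two terms coincide.
        rcases Nat.lt_or_ge n (j + k) with hjk | hjk
        · have h3 : G a (proj 𝒩 j l * proj 𝒩 k β) = 0 := by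
            rw [← map_zero (G a)]
            refine h.congr a fun m hm => ?_
            rw [proj_mul, map_zero]
            refine Finset.sum_eq_zero fun q hq => ?_
            have hq := Finset.HasAntidiagonal.mem_antidiagonal.1 hq
            rw [proj_proj, proj_proj]
            by_cases h4 : j = q.1
            · rw [if_neg (show k ≠ q.2 by omega), mul_zero]
            · rw [if_neg h4, zero_mul]
          rw [h3, sub_zero]
          calc _ ≤ (Λ * (M' * ε ^ k)) * (Λ * (M * ε ^ j)) := by
                refine ContinuousLinearMap.le_of_opNorm_le_of_le _ ?_ ?_
                · exact (h.norm_deriv_le a k β (by omega)).trans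
                    (mul_le_mul_of_nonneg_left (hs' k (by omega)) hΛ)
                · exact (h.norm_le a j l (by omega) (by omega)).trans
                    (mul_le_mul_of_nonneg_left (hs j (by omega)) hΛ)
            _ = Λ ^ 2 * M * M' * (ε ^ (j + k - (n + 1)) * ε ^ (n + 1)) := by
                rw [← pow_add, Nat.sub_add_cancel hjk, pow_add]; ring
            _ ≤ Λ ^ 2 * M * M' * ((1 + E) ^ n * ε ^ (n + 1)) := by
                have h5 : ε ^ (j + k - (n + 1)) ≤ (1 + E) ^ n :=
                  (pow_le_pow_left₀ h0 (by linarith) _).trans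
                    (pow_le_pow_right₀ (by linarith) (by omega))
                gcongr
            _ = _ := by ring
        · have h3 : D a (proj 𝒩 k β) (G a (proj 𝒩 j l)) = G a (proj 𝒩 j l * proj 𝒩 k β) := by
            rcases Nat.eq_zero_or_pos j with rfl | hj0
            · rw [proj_zero_of_mem_closedLie hl, map_zero, map_zero, zero_mul, map_zero]
            · exact h.lie a l hl β j k hj0 hjk
          rw [h3, sub_self, norm_zero]
          have : 0 ≤ 1 + E := by linarith
          positivity
    _ = _ := by simp; ring

end NewtonCalculus

/-- The telescoping identity behind Taylor's formula with the weights `(1 - r)^m / m!`. -/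
theorem sum_taylor_weights (g : ℕ → V) (r : ℝ) (N : ℕ) :
    ∑ m ∈ Finset.range (N + 1), (((m.factorial : ℝ)⁻¹ * (1 - r) ^ m) • g (m + 1) +
      ((m.factorial : ℝ)⁻¹ * (m * (1 - r) ^ (m - 1) * (-1))) • g m) =
      ((N.factorial : ℝ)⁻¹ * (1 - r) ^ N) • g (N + 1) := by
  induction N with
  | zero => simp
  | succ N ih =>
    rw [Finset.sum_range_succ, ih]
    have h1 : (((N + 1).factorial : ℝ)⁻¹ * ((N + 1 : ℕ) * (1 - r) ^ (N + 1 - 1) * (-1))) =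
        -((N.factorial : ℝ)⁻¹ * (1 - r) ^ N) := by
      rw [Nat.factorial_succ, Nat.add_sub_cancel]
      push_cast
      have : (N : ℝ) + 1 ≠ 0 := by positivity
      field_simp
    rw [h1, neg_smul]
    abel

/-- With l = log x, the function H(r) = ∑ (1 - r)^m / m! · F[l^m β](y_r) joins F[exp(l) β](a) =
F[xβ](a) at r = 0 to F[β](y_1) at r = 1. If differentiation along y were exactly multiplication by
l, its derivative would telescope to a multiple of F[l^{n+1} β], which vanishes after truncation.
Hence H' consists only of the errors of `norm_deriv_sub_le`. -/
theorem NewtonCalculus.exists_expansion (h : NewtonCalculus 𝒩 n Λ G D) (E M M' : ℝ) :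
    ∃ C, ∀ ε (x β : BTensor 𝒩) a y, 0 ≤ ε → ε ≤ E → proj 𝒩 0 x = 1 →
      logTrunc 𝒩 n x ∈ closedLie 𝒩 → Scaled n ε M (logTrunc 𝒩 n x) → Scaled n ε M' β →
      IsODESolution (fun b => G b (logTrunc 𝒩 n x)) a y →
      ‖G (y 1) β - G a (x * β)‖ ≤ C * ε ^ (n + 1) := by
  -- The constant of `norm_deriv_sub_le` for l^m β, whose size is given by `Scaled.pow_mul`.
  set K : ℕ → ℝ := fun m =>
    (n + 1) ^ 2 * (Λ ^ 2 * M * (((n + 1) * M) ^ m * M') * (1 + E) ^ n) with hK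
  refine ⟨∑ m ∈ Finset.range (n + 1), K m, fun ε x β a y h0 hE hx hlie hs hs' hy => ?_⟩
  set l := logTrunc 𝒩 n x with hl
  set H : ℝ → V := fun r => ∑ m ∈ Finset.range (n + 1),
    ((m.factorial : ℝ)⁻¹ * (1 - r) ^ m) • G (y r) (l ^ m * β) with hH
  have hd : ∀ r ∈ Icc (0 : ℝ) 1, HasDerivWithinAt H (∑ m ∈ Finset.range (n + 1),
      (((m.factorial : ℝ)⁻¹ * (1 - r) ^ m) • D (y r) (l ^ m * β) (G (y r) l) +
        ((m.factorial : ℝ)⁻¹ * (m * (1 - r) ^ (m - 1) * (-1))) • G (y r) (l ^ m * β)))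
      (Icc 0 1) r := by
    intro r hr
    refine HasDerivWithinAt.fun_sum fun m _ => ?_
    refine HasDerivWithinAt.smul ?_ ((h.hasFDerivAt _ (y r)).comp_hasDerivWithinAt r (hy.2 r hr))
    exact ((((hasDerivAt_id r).const_sub 1).pow m).const_mul _).hasDerivWithinAt
  have hb : ∀ r ∈ Ico (0 : ℝ) 1, ‖∑ m ∈ Finset.range (n + 1),
      (((m.factorial : ℝ)⁻¹ * (1 - r) ^ m) • D (y r) (l ^ m * β) (G (y r) l) +
        ((m.factorial : ℝ)⁻¹ * (m * (1 - r) ^ (m - 1) * (-1))) • G (y r) (l ^ m * β))‖ ≤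
      (∑ m ∈ Finset.range (n + 1), K m) * ε ^ (n + 1) := by
    intro r hr
    have h1 := sum_taylor_weights (fun m => G (y r) (l ^ m * β)) r n
    have h2 : G (y r) (l ^ (n + 1) * β) = 0 := by
      rw [← map_zero (G (y r))]
      refine h.congr _ fun k hk => ?_
      rw [proj_mul, map_zero]
      refine Finset.sum_eq_zero fun q hq => ?_
      have := Finset.HasAntidiagonal.mem_antidiagonal.1 hq
      rw [proj_pow_eq_zero (proj_zero_of_mem_closedLie hlie) (by omega), zero_mul]
    rw [h2, smul_zero] at h1
    -- Zero is subtracted in the form of the telescoping sum, so that each term is reduced to its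
    -- error.
    rw [← sub_zero (∑ m ∈ Finset.range (n + 1), _), ← h1, ← Finset.sum_sub_distrib,
      Finset.sum_mul]
    refine norm_sum_le_of_le _ fun m _ => ?_
    rw [add_sub_add_right_eq_sub, ← smul_sub, norm_smul, pow_succ', mul_assoc]
    have h3 := h.norm_deriv_sub_le hlie h0 hE hs (hs.pow_mul hs' h0 m) (y r)
    have h4 : ‖(m.factorial : ℝ)⁻¹ * (1 - r) ^ m‖ ≤ 1 := by
      have h5 : 0 ≤ 1 - r := by linarith [hr.2]
      have h6 : 1 - r ≤ 1 := by linarith [hr.1]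
      rw [Real.norm_of_nonneg (by positivity)]
      refine mul_le_one₀ ?_ (by positivity) (pow_le_one₀ h5 h6)
      exact inv_le_one_of_one_le₀ (by exact_mod_cast m.factorial_pos)
    exact (mul_le_of_le_one_left (norm_nonneg _) h4).trans h3
  have hfin := norm_image_sub_le_of_norm_deriv_le_segment_01' hd hb
  have h1 : H 1 = G (y 1) β := by
    rw [hH]
    simp only [sub_self]
    rw [Finset.sum_eq_single_of_mem 0 (by simp)]
    · simp
    · intro m _ hm
      rw [zero_pow hm, mul_zero, zero_smul]
  have h2 : H 0 = G a (x * β) := by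
    rw [hH]
    simp only [sub_zero, one_pow, mul_one, hy.1]
    rw [h.congr a ((exp_logTrunc (n := n) hx).mul (TruncEq.refl β)).symm, Finset.sum_mul, map_sum]
    refine Finset.sum_congr rfl fun m _ => ?_
    rw [btensor_smul_mul, map_smul]
  rwa [h1, h2] at hfin

end Expansion

/-! ### Controls and the comparison of D-solutions with almost flows -/

namespace IsControl

variable {T : ℝ} {ω : ℝ → ℝ → ℝ} {r s t : ℝ}

theorem le_right (h : IsControl T ω) (hr : 0 ≤ r) (hrs : r ≤ s) (hst : s ≤ t) (ht : t ≤ T) :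
    ω r s ≤ ω r t := by
  have h1 := h.superadd r s t hr hrs hst ht
  have h2 := h.nonneg s t (hr.trans hrs) hst ht
  linarith

theorem le_left (h : IsControl T ω) (hr : 0 ≤ r) (hrs : r ≤ s) (hst : s ≤ t) (ht : t ≤ T) :
    ω s t ≤ ω r t := by
  have h1 := h.superadd r s t hr hrs hst ht
  have h2 := h.nonneg r s hr hrs (hst.trans ht)
  linarith

theorem le_total (h : IsControl T ω) (hs : 0 ≤ s) (hst : s ≤ t) (ht : t ≤ T) : ω s t ≤ ω 0 T :=
  (h.le_right hs hst ht le_rfl).trans (h.le_left le_rfl hs (hst.trans ht) le_rfl)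

theorem diag (h : IsControl T ω) (hr : 0 ≤ r) (hT : r ≤ T) : ω r r = 0 := by
  have h1 := h.superadd r r r hr le_rfl le_rfl hT
  have h2 := h.nonneg r r hr le_rfl hT
  linarith

/-- A control can be halved, up to an interval on which it is arbitrarily small. -/
theorem exists_halving (h : IsControl T ω) (hr : 0 ≤ r) (hrt : r ≤ t) (ht : t ≤ T) {δ : ℝ}
    (hδ : 0 < δ) : ∃ u v, r ≤ u ∧ u ≤ v ∧ v ≤ t ∧ ω r u ≤ ω r t / 2 ∧ ω v t ≤ ω r t / 2 ∧
      ω u v ≤ δ := by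
  -- The supremum s of S need not belong to S. Superadditivity handles any v > s: since v ∉ S, more
  -- than half of the control lies before v. Taking u ∈ S just before s and v just after it,
  -- continuity at (s, s) makes the gap small; if s = t, then v = t.
  set S : Set ℝ := {u | r ≤ u ∧ u ≤ t ∧ ω r u ≤ ω r t / 2} with hS
  have h0 := h.nonneg r t hr hrt ht
  have hrS : r ∈ S := ⟨le_rfl, hrt, by rw [h.diag hr (hrt.trans ht)]; linarith⟩
  have hbdd : BddAbove S := ⟨t, fun u hu => hu.2.1⟩
  set s := sSup S with hs
  have hrs : r ≤ s := le_csSup hbdd hrS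
  have hst : s ≤ t := csSup_le ⟨r, hrS⟩ fun u hu => hu.2.1
  have hcont := h.cont_diag s (hr.trans hrs) (hst.trans ht)
  rw [Metric.continuousWithinAt_iff] at hcont
  obtain ⟨η, hη, hcont⟩ := hcont δ hδ
  obtain ⟨u, hu, hsu⟩ := exists_lt_of_lt_csSup ⟨r, hrS⟩ (show s - η < sSup S by linarith)
  have hus : u ≤ s := le_csSup hbdd hu
  have key : ∀ v, s ≤ v → v < s + η → v ≤ t → ω u v ≤ δ := by
    intro v hsv hv hvt
    have h1 := @hcont (u, v) ⟨hr.trans hu.1, hus.trans hsv, hvt.trans ht⟩ (by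
      rw [Prod.dist_eq, max_lt_iff, Real.dist_eq, Real.dist_eq, abs_lt, abs_lt]
      refine ⟨⟨?_, ?_⟩, ?_, ?_⟩ <;> simp only <;> linarith)
    simp only [Function.uncurry_apply_pair, h.diag (hr.trans hrs) (hst.trans ht), Real.dist_eq,
      sub_zero] at h1
    exact (le_abs_self _).trans h1.le
  rcases hst.eq_or_lt with heq | hlt
  · refine ⟨u, t, hu.1, hu.2.1, le_rfl, hu.2.2, ?_, key t hst (by linarith) le_rfl⟩
    rw [h.diag (hr.trans hrt) ht]
    linarith
  · set v := min t (s + η / 2) with hv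
    have hsv : s < v := lt_min hlt (by linarith)
    have hvt : v ≤ t := min_le_left _ _
    refine ⟨u, v, hu.1, hus.trans hsv.le, hvt, hu.2.2, ?_, key v hsv.le ?_ hvt⟩
    · have h1 : v ∉ S := fun hvS => absurd (le_csSup hbdd hvS) (not_le.2 hsv)
      have h2 : ω r t / 2 < ω r v := by
        by_contra h3
        exact h1 ⟨hrs.trans hsv.le, hvt, not_lt.1 h3⟩
      have h3 := h.superadd r v t hr (hrs.trans hsv.le) hvt ht
      linarith
    · exact (min_le_right _ _).trans_lt (by linarith)

end IsControl

variable {V : Type*} [NormedAddCommGroup V]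

/-- The scalar inequality which propagates the bounds from one dyadic scale to the next. -/
theorem dyadic_step {q θ θ' c B h K a : ℝ} (hc : 0 ≤ c) (hq : 0 < q) (hθ' : 1 < θ')
    (hB : 0 ≤ B) (hh : 0 ≤ h) (hK : 0 ≤ K) (ha : 0 ≤ a) :
    2 * (1 + c * h ^ q) * (Real.exp (c / (1 - 2 ^ (-q)) * (h / 2) ^ q) *
      (B / (1 - 2 ^ (1 - θ')) * (h / 2) ^ θ' + K * a * (h / 2) ^ θ)) + B * h ^ θ' ≤
    Real.exp (c / (1 - 2 ^ (-q)) * h ^ q) *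
      (B / (1 - 2 ^ (1 - θ')) * h ^ θ' + K * (a * 2 ^ (1 - θ)) * h ^ θ) := by
  have h1 : (2 : ℝ) ^ (-q) < 1 := Real.rpow_lt_one_of_one_lt_of_neg (by norm_num) (by linarith)
  have h2 : (2 : ℝ) ^ (1 - θ') < 1 :=
    Real.rpow_lt_one_of_one_lt_of_neg (by norm_num) (by linarith)
  have h1' : 0 < 1 - (2 : ℝ) ^ (-q) := by linarith
  have h2' : 0 < 1 - (2 : ℝ) ^ (1 - θ') := by linarith
  set κ := c / (1 - 2 ^ (-q)) with hκ
  set E := B / (1 - 2 ^ (1 - θ')) with hE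
  -- The values of κ and E are the fixed points of the recursion: κ absorbs the factor 1 + c h^q ≤
  -- exp(c h^q), and E absorbs the new defect B h^{θ'}.
  have hκc : κ * (1 - 2 ^ (-q)) = c := div_mul_cancel₀ _ h1'.ne'
  have hEB : E * (1 - 2 ^ (1 - θ')) = B := div_mul_cancel₀ _ h2'.ne'
  have hκ0 : 0 ≤ κ := by positivity
  have hE0 : 0 ≤ E := by positivity
  have hdiv : ∀ α : ℝ, (h / 2) ^ α = h ^ α * 2 ^ (-α) := fun α => by
    rw [Real.div_rpow hh (by norm_num), Real.rpow_neg (by norm_num), div_eq_mul_inv]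
  have htwo : ∀ α : ℝ, (2 : ℝ) ^ (1 - α) = 2 * 2 ^ (-α) := fun α => by
    rw [sub_eq_add_neg, Real.rpow_add (by norm_num), Real.rpow_one]
  have hexp : (1 + c * h ^ q) * Real.exp (κ * (h / 2) ^ q) ≤ Real.exp (κ * h ^ q) := by
    calc _ ≤ Real.exp (c * h ^ q) * Real.exp (κ * (h / 2) ^ q) := by
          gcongr
          linarith [Real.add_one_le_exp (c * h ^ q)]
      _ = Real.exp (κ * h ^ q) := by
          rw [← Real.exp_add, hdiv, ← hκc]
          congr 1
          ring
  have hone : 1 ≤ Real.exp (κ * h ^ q) := Real.one_le_exp (by positivity)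
  calc _ = ((1 + c * h ^ q) * Real.exp (κ * (h / 2) ^ q)) *
        (E * 2 ^ (1 - θ') * h ^ θ' + K * (a * 2 ^ (1 - θ)) * h ^ θ) + 1 * (B * h ^ θ') := by
        rw [hdiv θ', hdiv θ, htwo θ', htwo θ]; ring
    _ ≤ Real.exp (κ * h ^ q) *
        (E * 2 ^ (1 - θ') * h ^ θ' + K * (a * 2 ^ (1 - θ)) * h ^ θ) +
          Real.exp (κ * h ^ q) * (B * h ^ θ') := by gcongr
    _ = _ := by rw [← hEB]; ring

/-- A path which follows an almost flow up to some error `o(ω)` follows it up to the error of the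
almost flow, with a constant which does not depend on the path. -/
theorem exists_consistency_const {T : ℝ} {ω : ℝ → ℝ → ℝ} (hω : IsControl T ω) {q θ' : ℝ}
    (hq : 0 < q) (hθ' : 1 < θ') {φ : ℝ → ℝ → V → V} {c B : ℝ} (hc : 0 ≤ c) (hB : 0 ≤ B)
    (hlip : ∀ s t, 0 ≤ s → s ≤ t → t ≤ T → ∀ a b,
      ‖φ t s a - φ t s b‖ ≤ (1 + c * ω s t ^ q) * ‖a - b‖)
    (hflow : ∀ r s t, 0 ≤ r → r ≤ s → s ≤ t → t ≤ T → ∀ a,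
      ‖φ t s (φ s r a) - φ t r a‖ ≤ B * ω r t ^ θ') :
    ∃ C, 0 ≤ C ∧ ∀ (z : ℝ → V) (θ K : ℝ), 1 < θ →
      (∀ s t, 0 ≤ s → s ≤ t → t ≤ T → ‖z t - φ t s (z s)‖ ≤ K * ω s t ^ θ) →
      ∀ s t, 0 ≤ s → s ≤ t → t ≤ T → ‖z t - φ t s (z s)‖ ≤ C * ω s t ^ θ' := by
  -- The number w bounds all Lipschitz constants of φ. Composing over three pieces produces ℓ² and
  -- two defects, which c' and B' bring back to the form required by `dyadic_step`. The absolute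
  -- value keeps the constants nonnegative without a sign condition on T.
  set w := 1 + c * |ω 0 T| ^ q with hw
  set c' := c * (1 + w) with hc'
  set B' := (1 + w) * B with hB'
  set κ := c' / (1 - 2 ^ (-q)) with hκ
  set E := B' / (1 - 2 ^ (1 - θ')) with hE
  have hw0 : 0 ≤ w := by positivity
  have hc'0 : 0 ≤ c' := by positivity
  have hB'0 : 0 ≤ B' := by positivity
  have h1 : (2 : ℝ) ^ (-q) < 1 := Real.rpow_lt_one_of_one_lt_of_neg (by norm_num) (by linarith)
  have h2 : (2 : ℝ) ^ (1 - θ') < 1 :=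
    Real.rpow_lt_one_of_one_lt_of_neg (by norm_num) (by linarith)
  have hκ0 : 0 ≤ κ := div_nonneg hc'0 (by linarith)
  have hE0 : 0 ≤ E := div_nonneg hB'0 (by linarith)
  refine ⟨Real.exp (κ * |ω 0 T| ^ q) * E, by positivity, fun z θ K hθ hz => ?_⟩
  have hz' : ∀ s t, 0 ≤ s → s ≤ t → t ≤ T → ‖z t - φ t s (z s)‖ ≤ |K| * ω s t ^ θ :=
    fun s t hs hst ht => (hz s t hs hst ht).trans
      (mul_le_mul_of_nonneg_right (le_abs_self K) (Real.rpow_nonneg (hω.nonneg s t hs hst ht) _))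
  have hlip' : ∀ s t, 0 ≤ s → s ≤ t → t ≤ T → ω s t ^ q ≤ |ω 0 T| ^ q := fun s t hs hst ht =>
    Real.rpow_le_rpow (hω.nonneg s t hs hst ht) ((hω.le_total hs hst ht).trans (le_abs_self _))
      hq.le
  have h3pt : ∀ r s t, 0 ≤ r → r ≤ s → s ≤ t → t ≤ T → ‖z t - φ t r (z r)‖ ≤
      ‖z t - φ t s (z s)‖ + (1 + c * ω s t ^ q) * ‖z s - φ s r (z r)‖ + B * ω r t ^ θ' := by
    intro r s t hr hrs hst ht
    have e1 : z t - φ t r (z r) = (z t - φ t s (z s)) + (φ t s (z s) - φ t s (φ s r (z r))) +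
        (φ t s (φ s r (z r)) - φ t r (z r)) := by abel
    rw [e1]
    exact (norm_add₃_le).trans (add_le_add (add_le_add le_rfl
      (hlip s t (hr.trans hrs) hst ht _ _)) (hflow r s t hr hrs hst ht _))
  -- M counts halvings: each one multiplies the term in |K| by 2^{1-θ} and leaves the other
  -- coefficient unchanged.
  have main : ∀ (M : ℕ) r t, 0 ≤ r → r ≤ t → t ≤ T → ‖z t - φ t r (z r)‖ ≤
      Real.exp (κ * ω r t ^ q) * (E * ω r t ^ θ' + |K| * (2 ^ (1 - θ)) ^ M * ω r t ^ θ) := by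
    intro M
    induction M with
    | zero =>
      intro r t hr hrt ht
      have h0 := hω.nonneg r t hr hrt ht
      have hone : 1 ≤ Real.exp (κ * ω r t ^ q) := Real.one_le_exp (by positivity)
      refine (hz' r t hr hrt ht).trans ?_
      rw [pow_zero, mul_one]
      have h3 : 0 ≤ |K| * ω r t ^ θ := by positivity
      have h4 : 0 ≤ E * ω r t ^ θ' := by positivity
      nlinarith
    | succ M ih =>
      intro r t hr hrt ht
      have h0 := hω.nonneg r t hr hrt ht
      set h := ω r t with hh
      set b := Real.exp (κ * (h / 2) ^ q) *
        (E * (h / 2) ^ θ' + |K| * (2 ^ (1 - θ)) ^ M * (h / 2) ^ θ) with hb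
      set ℓ := 1 + c * h ^ q with hℓ
      have hℓ1 : 1 ≤ ℓ := by rw [hℓ]; linarith [show 0 ≤ c * h ^ q by positivity]
      have hℓw : ℓ ≤ w := by
        rw [hℓ, hw]
        have := mul_le_mul_of_nonneg_left (hlip' r t hr hrt ht) hc
        linarith
      have hb0 : 0 ≤ b := by positivity
      have hmono : ∀ r' t', 0 ≤ r' → r' ≤ t' → t' ≤ T → ω r' t' ≤ h / 2 →
          ‖z t' - φ t' r' (z r')‖ ≤ b := by
        intro r' t' hr' hrt' ht' hle
        have h3 := hω.nonneg r' t' hr' hrt' ht'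
        refine (ih r' t' hr' hrt' ht').trans ?_
        rw [hb]
        gcongr
      -- On [r, u] and [v, t] the induction hypothesis applies; on the gap [u, v] the a priori bound
      -- contributes |K| δ^θ, which disappears as δ → 0.
      have hδ : ∀ δ : ℝ, 0 < δ → ‖z t - φ t r (z r)‖ ≤
          b + ℓ * (|K| * δ ^ θ + ℓ * b + B * h ^ θ') + B * h ^ θ' := by
        intro δ hδ
        obtain ⟨u, v, hru, huv, hvt, hu, hv, huvδ⟩ := hω.exists_halving hr hrt ht hδ
        have h0u := hr.trans hru
        have h0v := h0u.trans huv
        have hvT := hvt.trans ht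
        have huT := huv.trans hvT
        have hrv := hru.trans huv
        have hωuv := hω.nonneg u v h0u huv hvT
        have hωvt := hω.nonneg v t h0v hvt ht
        have e1 := h3pt r v t hr hrv hvt ht
        have e2 := h3pt r u v hr hru huv hvT
        have e3 : ‖z v - φ v r (z r)‖ ≤ |K| * δ ^ θ + ℓ * b + B * h ^ θ' := by
          refine e2.trans ?_
          have hrvh := hω.le_right hr hrv hvt ht
          have huvh := (hω.le_left hr hru huv hvT).trans hrvh
          have hωrv := hω.nonneg r v hr hrv hvT
          have i1 : ‖z v - φ v u (z u)‖ ≤ |K| * δ ^ θ :=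
            (hz' u v h0u huv hvT).trans (by gcongr)
          have i2 := hmono r u hr hru huT hu
          rw [hℓ]
          gcongr
        refine e1.trans ?_
        have hvth := hω.le_left hr hrv hvt ht
        have i1 := hmono v t h0v hvt ht hv
        rw [hℓ] at e3 ⊢
        gcongr
      have hlim : ‖z t - φ t r (z r)‖ ≤ b + ℓ * (ℓ * b + B * h ^ θ') + B * h ^ θ' := by
        have ht0 : Filter.Tendsto (fun δ : ℝ => b + ℓ * (|K| * δ ^ θ + ℓ * b + B * h ^ θ') +
            B * h ^ θ') (nhdsWithin 0 (Ioi 0))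
            (nhds (b + ℓ * (|K| * (0 : ℝ) ^ θ + ℓ * b + B * h ^ θ') + B * h ^ θ')) := by
          refine Filter.Tendsto.mono_left ?_ nhdsWithin_le_nhds
          have := (Real.continuous_rpow_const (q := θ) (by linarith)).tendsto (0 : ℝ)
          exact ((((this.const_mul _).add_const _).add_const _).const_mul _ |>.const_add _
            |>.add_const _)
        rw [Real.zero_rpow (by linarith), mul_zero, zero_add] at ht0
        refine ge_of_tendsto ht0 ?_
        filter_upwards [self_mem_nhdsWithin] with δ hδ' using hδ δ hδ'
      have hfin := dyadic_step (θ := θ) (a := (2 ^ (1 - θ)) ^ M) hc'0 hq hθ' hB'0 h0 (abs_nonneg K)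
        (by positivity)
      rw [pow_succ]
      refine hlim.trans (le_trans ?_ hfin)
      have hhθ : 0 ≤ h ^ θ' := by positivity
      have k1 : b + ℓ * (ℓ * b) ≤ 2 * (1 + c' * h ^ q) * b := by
        have : 1 + ℓ * ℓ ≤ 2 * (1 + c' * h ^ q) := by
          have k3 : 0 ≤ c * h ^ q := by positivity
          have k4 : c * h ^ q * ℓ ≤ c * h ^ q * w := mul_le_mul_of_nonneg_left hℓw k3
          have k5 : ℓ * ℓ = ℓ + c * h ^ q * ℓ := by rw [hℓ]; ring
          have k6 : c' * h ^ q = c * h ^ q + c * h ^ q * w := by rw [hc']; ring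
          have k7 : 0 ≤ c * h ^ q * w := by positivity
          rw [k5, k6]
          linarith
        nlinarith
      have k2 : ℓ * (B * h ^ θ') + B * h ^ θ' ≤ B' * h ^ θ' := by
        have : ℓ * (B * h ^ θ') ≤ w * (B * h ^ θ') :=
          mul_le_mul_of_nonneg_right hℓw (by positivity)
        rw [hB']
        linarith
      linarith
  intro s t hs hst ht
  have h0 := hω.nonneg s t hs hst ht
  -- As M → ∞ the term in |K| vanishes, and with it all dependence on the path.
  have hρ : Filter.Tendsto (fun M : ℕ => Real.exp (κ * ω s t ^ q) *
      (E * ω s t ^ θ' + |K| * (2 ^ (1 - θ)) ^ M * ω s t ^ θ)) Filter.atTop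
      (nhds (Real.exp (κ * ω s t ^ q) * (E * ω s t ^ θ' + |K| * 0 * ω s t ^ θ))) :=
    ((((tendsto_pow_atTop_nhds_zero_of_lt_one (by positivity)
      (Real.rpow_lt_one_of_one_lt_of_neg (by norm_num) (by linarith))).const_mul _).mul_const
        _).const_add _).const_mul _
  have h3 := ge_of_tendsto' hρ fun M => main M s t hs hst ht
  rw [mul_zero, zero_mul, add_zero, ← mul_assoc] at h3
  have h4 := hlip' s t hs hst ht
  exact h3.trans (by gcongr)

/-! ### Time-one maps -/

section TimeOne

variable {V : Type*} [NormedAddCommGroup V] [NormedSpace ℝ V]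

open scoped NNReal

theorem exists_isODESolution [CompleteSpace V] {X : V → V} {K : ℝ≥0} (hX : LipschitzWith K X)
    {B : ℝ} (hB : ∀ a, ‖X a‖ ≤ B) (a : V) : ∃ y, IsODESolution X a y := by
  have h0 : 0 ≤ B := (norm_nonneg _).trans (hB a)
  -- A field bounded by B moves a point by at most B in unit time, so the ball of radius B makes
  -- Picard-Lindelöf valid on all of [0, 1].
  have hPL : IsPicardLindelof (fun _ : ℝ => X) (tmin := 0) (tmax := 1)
      ⟨0, le_rfl, zero_le_one⟩ a B.toNNReal 0 B.toNNReal K :=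
    IsPicardLindelof.of_time_independent
      (fun x _ => by rw [Real.coe_toNNReal _ h0]; exact hB x) hX.lipschitzOnWith (by simp)
  exact hPL.exists_eq_forall_mem_Icc_hasDerivWithinAt₀

theorem timeOne_spec {X : V → V} {a : V} (h : ∃ y, IsODESolution X a y) :
    ∃ y, IsODESolution X a y ∧ timeOne X a = y 1 :=
  ⟨h.choose, h.choose_spec, by rw [timeOne, dif_pos h]⟩

theorem IsODESolution.dist_le {X : V → V} {K : ℝ≥0} (hX : LipschitzWith K X) {a b : V}
    {y z : ℝ → V} (hy : IsODESolution X a y) (hz : IsODESolution X b z) :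
    dist (y 1) (z 1) ≤ dist a b * Real.exp K := by
  have key : ∀ {y : ℝ → V} {a : V}, IsODESolution X a y →
      ∀ t ∈ Ico (0 : ℝ) 1, HasDerivWithinAt y (X (y t)) (Ici t) t := fun h t ht =>
    (h.2 t ⟨ht.1, ht.2.le⟩).mono_of_mem_nhdsWithin (Icc_mem_nhdsGE_of_mem ht)
  have := dist_le_of_trajectories_ODE (v := fun _ => X) (fun _ => hX)
    (fun t ht => (hy.2 t ht).continuousWithinAt) (key hy)
    (fun t ht => (hz.2 t ht).continuousWithinAt) (key hz) (δ := dist a b)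
    (by rw [hy.1, hz.1]) 1 ⟨zero_le_one, le_rfl⟩
  simpa using this

end TimeOne

/-! ### The log-ODE approximation is an almost flow -/

section LogODE

variable {U : Type*} [NormedAddCommGroup U] [NormedSpace ℝ U] {𝒩 : TensorNorm U}
  {V : Type*} [NormedAddCommGroup V] [NormedSpace ℝ V] {I : Type*}
  {e : Module.Basis I ℝ U} {f : I → V → V} {n : ℕ} {N : ℕ∞} {p T : ℝ} {ω : ℝ → ℝ → ℝ}
  {x : ℝ → ℝ → BTensor 𝒩}

theorem rpow_inv_pow {c : ℝ} (hc : 0 ≤ c) (p : ℝ) (k : ℕ) :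
    (c ^ (1 / p)) ^ k = c ^ ((k : ℝ) / p) := by
  rw [← Real.rpow_natCast, ← Real.rpow_mul hc]
  congr 1
  ring

theorem IsRoughPath.exists_scaled (hω : IsControl T ω) (hx : IsRoughPath 𝒩 N p T ω x) (n : ℕ) :
    ∃ M, ∀ s t, 0 ≤ s → s ≤ t → t ≤ T → Scaled n (ω s t ^ (1 / p)) M (x s t) := by
  obtain ⟨μ, hμ⟩ := hx.bound
  refine ⟨‖(1 : BTensor 𝒩)‖ + ∑ i ∈ Finset.range (n + 1), |μ i|, fun s t hs hst ht k hk => ?_⟩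
  have h0 := hω.nonneg s t hs hst ht
  have hsum : 0 ≤ ∑ i ∈ Finset.range (n + 1), |μ i| := Finset.sum_nonneg fun _ _ => abs_nonneg _
  rcases Nat.eq_zero_or_pos k with rfl | hk0
  · rw [hx.proj_zero s t hs hst ht, pow_zero, mul_one]
    linarith
  · refine (hμ k hk0 s t hs hst ht).trans ?_
    rw [rpow_inv_pow h0]
    refine mul_le_mul_of_nonneg_right ?_ (Real.rpow_nonneg h0 _)
    have h1 := Finset.single_le_sum (f := fun i => |μ i|) (fun _ _ => abs_nonneg _)
      (Finset.mem_range.2 (Nat.lt_succ_of_le hk))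
    have h2 := norm_nonneg (1 : BTensor 𝒩)
    have h3 := le_abs_self (μ k)
    linarith

/-- The Lipschitz bound is Grönwall for a field of Lipschitz constant O(ω^{1/p}). The other two
estimates are the expansion along the flow, with β = 1 and with β = x_{s,t}; in the latter, Chen's
relation turns x_{r,s} x_{s,t} into x_{r,t}. -/
theorem exists_logODE_estimates [CompleteSpace V] (hf : ∀ i, ContDiff ℝ n (f i))
    (hF : NewtonBound 𝒩 e f n) (hp : 0 < p) (hω : IsControl T ω) (hN : (n : ℕ∞) ≤ N)
    (hx : IsWeakGeometric 𝒩 N p T ω x) :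
    ∃ c B : ℝ, 0 ≤ c ∧ 0 ≤ B ∧
      (∀ s t, 0 ≤ s → s ≤ t → t ≤ T → ∀ a b,
        ‖logODE 𝒩 e f n x t s a - logODE 𝒩 e f n x t s b‖ ≤
          (1 + c * ω s t ^ (1 / p)) * ‖a - b‖) ∧
      (∀ s t, 0 ≤ s → s ≤ t → t ≤ T → ∀ a,
        ‖logODE 𝒩 e f n x t s a - newtonMap 𝒩 e f n (x s t) a‖ ≤
          B * ω s t ^ (((n : ℝ) + 1) / p)) ∧
      (∀ r s t, 0 ≤ r → r ≤ s → s ≤ t → t ≤ T → ∀ a,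
        ‖logODE 𝒩 e f n x t s (logODE 𝒩 e f n x s r a) - logODE 𝒩 e f n x t r a‖ ≤
          B * ω r t ^ (((n : ℝ) + 1) / p)) := by
  obtain ⟨Λ, hΛ⟩ := hF.exists_const
  obtain ⟨G, D, hGnewton, hG⟩ := hΛ.exists_calculus hf
  obtain ⟨M, hM⟩ := hx.toIsRoughPath.exists_scaled hω n
  obtain ⟨M', hM'⟩ := exists_scaled_logTrunc 𝒩 n M
  have hp' : 0 < 1 / p := by positivity
  set W := |ω 0 T| ^ (1 / p) with hW
  obtain ⟨C₁, hC₁⟩ := hG.exists_expansion W M' ‖(1 : BTensor 𝒩)‖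
  obtain ⟨C₂, hC₂⟩ := hG.exists_expansion W M' M
  have hε0 : ∀ s t, 0 ≤ s → s ≤ t → t ≤ T → 0 ≤ ω s t ^ (1 / p) := fun s t hs hst ht =>
    Real.rpow_nonneg (hω.nonneg s t hs hst ht) _
  have hεW : ∀ s t, 0 ≤ s → s ≤ t → t ≤ T → ω s t ^ (1 / p) ≤ W := fun s t hs hst ht =>
    Real.rpow_le_rpow (hω.nonneg s t hs hst ht) ((hω.le_total hs hst ht).trans (le_abs_self _))
      hp'.le
  have hpow : ∀ s t, 0 ≤ s → s ≤ t → t ≤ T →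
      (ω s t ^ (1 / p)) ^ (n + 1) = ω s t ^ (((n : ℝ) + 1) / p) := fun s t hs hst ht => by
    rw [rpow_inv_pow (hω.nonneg s t hs hst ht)]; push_cast; rfl
  have hlog : ∀ s t, 0 ≤ s → s ≤ t → t ≤ T →
      Scaled n (ω s t ^ (1 / p)) M' (logTrunc 𝒩 n (x s t)) := fun s t hs hst ht =>
    hM' _ _ (hε0 s t hs hst ht) (hM s t hs hst ht) (hx.proj_zero s t hs hst ht)
  have hlie : ∀ s t, 0 ≤ s → s ≤ t → t ≤ T → logTrunc 𝒩 n (x s t) ∈ closedLie 𝒩 :=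
    hx.log_mem n hN
  have hodef : ∀ s t a, logODE 𝒩 e f n x t s a =
      timeOne (fun b => G b (logTrunc 𝒩 n (x s t))) a := fun s t a => by
    rw [logODE, funext (hGnewton (logTrunc 𝒩 n (x s t)))]
  have hsol : ∀ s t, 0 ≤ s → s ≤ t → t ≤ T → ∀ a, ∃ y,
      IsODESolution (fun b => G b (logTrunc 𝒩 n (x s t))) a y ∧
        logODE 𝒩 e f n x t s a = y 1 := by
    intro s t hs hst ht a
    rw [hodef]
    -- Without a constant term the field contains no multiple of the identity, so it is bounded as
    -- well as Lipschitz, and solutions exist.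
    have h0 := proj_zero_of_mem_closedLie (hlie s t hs hst ht)
    exact timeOne_spec (exists_isODESolution (hG.lipschitz h0)
      (fun b => hG.norm_le_sum b h0) a)
  have heuler : ∀ s t, 0 ≤ s → s ≤ t → t ≤ T → ∀ a,
      ‖logODE 𝒩 e f n x t s a - newtonMap 𝒩 e f n (x s t) a‖ ≤
        |C₁| * (ω s t ^ (1 / p)) ^ (n + 1) := by
    intro s t hs hst ht a
    obtain ⟨y, hy, hy1⟩ := hsol s t hs hst ht a
    have hε := hε0 s t hs hst ht
    have h1 := hC₁ _ (x s t) 1 a y hε (hεW s t hs hst ht) (hx.proj_zero s t hs hst ht)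
      (hlie s t hs hst ht) (hlog s t hs hst ht) (scaled_one 𝒩 n hε) hy
    rw [hG.one, mul_one] at h1
    rw [hy1, hGnewton]
    exact h1.trans (by gcongr; exact le_abs_self _)
  set κ := n * Λ * |M'| * (1 + W) ^ n with hκ
  have hΛ0 := hG.nonneg
  have hκ0 : 0 ≤ κ := by positivity
  -- The flow defect costs one expansion along [r, s] and two comparisons of the log-ODE with F[x],
  -- on [s, t] and on [r, t].
  refine ⟨κ * Real.exp (κ * W), |C₂| + 2 * |C₁|, by positivity, by positivity, ?_, ?_, ?_⟩
  · intro s t hs hst ht a b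
    obtain ⟨y, hy, hy1⟩ := hsol s t hs hst ht a
    obtain ⟨z, hz, hz1⟩ := hsol s t hs hst ht b
    have hε := hε0 s t hs hst ht
    have h0 := proj_zero_of_mem_closedLie (hlie s t hs hst ht)
    have h1 := hy.dist_le (hG.lipschitz h0) hz
    have h2 := hG.sum_norm_proj_le hε (hεW s t hs hst ht) (hlog s t hs hst ht)
    rw [Real.coe_toNNReal _ (Finset.sum_nonneg fun k _ => mul_nonneg hΛ0 (norm_nonneg _)),
      dist_eq_norm, dist_eq_norm] at h1
    rw [hy1, hz1]
    refine h1.trans ?_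
    rw [mul_comm]
    refine mul_le_mul_of_nonneg_right ?_ (norm_nonneg _)
    set u := κ * ω s t ^ (1 / p) with hu
    have hu0 : 0 ≤ u := by positivity
    have h3 : ∑ k ∈ Finset.Icc 1 n, Λ * ‖proj 𝒩 k (logTrunc 𝒩 n (x s t))‖ ≤ u := by
      refine h2.trans ?_
      rw [hu, hκ]
      gcongr
      exact le_abs_self _
    have h4 : u ≤ κ * W := mul_le_mul_of_nonneg_left (hεW s t hs hst ht) hκ0
    have h5 : Real.exp u ≤ 1 + u * Real.exp u := by
      have h6 := Real.add_one_le_exp (-u)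
      have h7 : Real.exp (-u) * Real.exp u = 1 := by rw [← Real.exp_add, neg_add_cancel,
        Real.exp_zero]
      have h8 := mul_le_mul_of_nonneg_right h6 (Real.exp_pos u).le
      linarith
    calc _ ≤ Real.exp u := Real.exp_le_exp.2 h3
      _ ≤ 1 + u * Real.exp u := h5
      _ ≤ 1 + u * Real.exp (κ * W) := by gcongr
      _ = _ := by rw [hu]; ring
  · intro s t hs hst ht a
    rw [← hpow s t hs hst ht]
    have hε := hε0 s t hs hst ht
    refine (heuler s t hs hst ht a).trans ?_
    have h1 := abs_nonneg C₁
    have h2 := abs_nonneg C₂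
    gcongr
    linarith
  · intro r s t hr hrs hst ht a
    have hs := hr.trans hrs
    have hrt := hrs.trans hst
    have hsT := hst.trans ht
    rw [← hpow r t hr hrt ht]
    obtain ⟨y, hy, hy1⟩ := hsol r s hr hrs hsT a
    have hε := hε0 r t hr hrt ht
    have hεrs : ω r s ^ (1 / p) ≤ ω r t ^ (1 / p) := Real.rpow_le_rpow
      (hω.nonneg r s hr hrs hsT) (hω.le_right hr hrs hst ht) hp'.le
    have hεst : ω s t ^ (1 / p) ≤ ω r t ^ (1 / p) := Real.rpow_le_rpow
      (hω.nonneg s t hs hst ht) (hω.le_left hr hrs hst ht) hp'.le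
    -- Both increments are measured with the common scale ε = ω_{r,t}^{1/p}.
    have h1 := hC₂ _ (x r s) (x s t) a y hε (hεW r t hr hrt ht) (hx.proj_zero r s hr hrs hsT)
      (hlie r s hr hrs hsT) ((hlog r s hr hrs hsT).mono (hε0 r s hr hrs hsT) hεrs le_rfl)
      ((hM s t hs hst ht).mono (hε0 s t hs hst ht) hεst le_rfl) hy
    have hchen : TruncEq n (x r s * x s t) (x r t) := fun k hk =>
      hx.chen r s t hr hrs hst ht k ((Nat.cast_le.2 hk).trans hN)
    rw [hG.congr a hchen] at h1
    have h2 := heuler s t hs hst ht (y 1)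
    have h3 := heuler r t hr hrt ht a
    rw [hGnewton] at h2 h3
    rw [norm_sub_rev] at h3
    have h4 : |C₁| * (ω s t ^ (1 / p)) ^ (n + 1) ≤ |C₁| * (ω r t ^ (1 / p)) ^ (n + 1) := by
      have := hε0 s t hs hst ht
      gcongr
    have h5 : C₂ * (ω r t ^ (1 / p)) ^ (n + 1) ≤ |C₂| * (ω r t ^ (1 / p)) ^ (n + 1) := by
      gcongr
      exact le_abs_self _
    rw [hy1]
    have e1 : logODE 𝒩 e f n x t s (y 1) - logODE 𝒩 e f n x t r a =
        (logODE 𝒩 e f n x t s (y 1) - G (y 1) (x s t)) + (G (y 1) (x s t) - G a (x r t)) +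
          (G a (x r t) - logODE 𝒩 e f n x t r a) := by abel
    rw [e1]
    refine norm_add₃_le.trans ?_
    linarith

end LogODE

end

end RoughConsistency

theorem mainTheorem6 {U V I : Type*}
    [NormedAddCommGroup U] [NormedSpace ℝ U] [CompleteSpace U]
    [NormedAddCommGroup V] [NormedSpace ℝ V] [CompleteSpace V]
    (e : I → U) (he : LinearIndependent ℝ e)
    (hdense : Dense (Submodule.span ℝ (Set.range e) : Set U))
    (𝒩 : TensorNorm (Submodule.span ℝ (Set.range e)))
    (n : ℕ) (p : ℝ) (hp : 1 ≤ p) (hn : p < (n : ℝ) + 1)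
    (f : I → V → V) (hf : ∀ i, ContDiff ℝ n (f i))
    (hF : NewtonBound 𝒩 (Module.Basis.span he) f n)
    (T : ℝ) (hT : 0 ≤ T) (ω : ℝ → ℝ → ℝ) (hω : IsControl T ω)
    (N : ℕ∞) (hN : (n : ℕ∞) ≤ N)
    (x : ℝ → ℝ → BTensor 𝒩) (hx : IsWeakGeometric 𝒩 N p T ω x) :
    ∃ C : ℝ, ∀ z : ℝ → V, IsDSolution 𝒩 (Module.Basis.span he) f n T ω x z →
      ∀ s t, 0 ≤ s → s ≤ t → t ≤ T →
        ‖z t - newtonMap 𝒩 (Module.Basis.span he) f n (x s t) (z s)‖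
            ≤ C * ω s t ^ (((n : ℝ) + 1) / p) ∧
        ‖z t - logODE 𝒩 (Module.Basis.span he) f n x t s (z s)‖
            ≤ C * ω s t ^ (((n : ℝ) + 1) / p) := by
  have hp0 : 0 < p := by linarith
  obtain ⟨c, B, hc, hB, hlip, heuler, hflow⟩ := exists_logODE_estimates hf hF hp0 hω hN hx
  obtain ⟨C, hC, hcons⟩ := exists_consistency_const hω (q := 1 / p) (by positivity)
    ((one_lt_div hp0).2 hn) hc hB hlip hflow
  -- C controls the distance to the log-ODE, and B the passage from the log-ODE to F[x].
  refine ⟨C + B, fun z hz s t hs hst ht => ?_⟩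
  obtain ⟨_, θ, hθ, K, hK⟩ := hz
  have h1 := hcons z θ K hθ hK s t hs hst ht
  have h2 := heuler s t hs hst ht (z s)
  have h3 := Real.rpow_nonneg (hω.nonneg s t hs hst ht) (((n : ℝ) + 1) / p)
  have h4 := mul_nonneg hB h3
  rw [add_mul]
  refine ⟨?_, by linarith⟩
  refine (norm_sub_le_norm_sub_add_norm_sub _ (logODE 𝒩 (Module.Basis.span he) f n x t s (z s))
    _).trans ?_
  linarith
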